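/- **Setting.** There are $A\ge 1$ arms, $[A]=\{1,\dots,A\}$, and $D\ge 1$ objectives. In each round $t=1,2,\dots$ the learner selects an arm $a(t)\in[A]$ and observes $r(t)=\mu_{a(t)}+\kappa(t)\in\mathbb R^D$; given the past and $a(t)=a$, the noise vector $\kappa(t)$ is drawn from a fixed unknown law $\nu_a$ on $\mathbb R^D$ whose marginals have mean zero and are $1$-sub-Gaussian, $\mathbb E[e^{\lambda\kappa^i(t)}\mid a(t)=a]\le e^{\lambda^2/2}$ for all $\lambda\in\mathbb R$. A vector $x$ lexicographically dominates $y$ in the first $i$ objectives if there is $j\le i$ with $x^k=y^k$ for all $k<j$ and $x^j>y^j$. Let $\mathcal A_*^i$ be the set of arms $a$ such that no $\mu_{a'}$ dominates $\mu_a$ in the first $i$ objectives ($\mathcal A_*^0=[A]$), let $\mathcal S_*^i=\mathcal A_*^{i-1}\setminus\mathcal A_*^i$, let $\mu_*$ be the mean vector of an arm in $\mathcal A_*^D$, and put $\Delta_a^i=\mu_*^i-\mu_a^i$, $\Delta_{\max}^i=\max_a\Delta_a^i$, $\mathrm{Reg}_{pb}^i(T)=\sum_{t=1}^T\Delta^i_{a(t)}\mathbb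 I\{a(t)\in\mathcal S_*^i\}$. **Algorithm PF-LEX$(\epsilon,\delta)$.** At the beginning of round $t$ let $N_a$ be the number of past selections of $a$, $\hat\mu_a^i$ the sample mean of the rewards of $a$ in objective $i$ (with $\hat\mu_a^i=0$ if $N_a=0$), $$c_a=\sqrt{\tfrac{1+N_a}{N_a^2}\Big(1+2\log\tfrac{AD\sqrt{1+N_a}}{\delta}\Big)}\quad(c_a=\infty\text{ if }N_a=0),\qquad u_a^i=\hat\mu_a^i+c_a,\quad l_a^i=\hat\mu_a^i-c_a .$$ Arms $a,b$ are linked in objective $i$ if $[l_a^i,u_a^i]\cap[l_b^i,u_b^i]\ne\emptyset$. Put $\hat{\mathcal A}_*^0=[A]$ and, for $i\ge1$, let $\hat a_*^i$ maximize $u_a^i$ over $a\in\hat{\mathcal A}_*^{i-1}$ and let $\hat{\mathcal A}_*^i$ be the set of arms of $\hat{\mathcal A}_*^{i-1}$ that are related to $\hat a_*^i$ by the transitive closure of the linked relation in objective $i$ on $\hat{\mathcal A}_*^{i-1}$. If some $a\in\hat{\mathcal A}_*^1$ has $c_a>\epsilon/2$, select one such arm uniformly at random; otherwise select $a(t)=\hat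 a_*^D$, a maximizer of $u_a^D$ over $\hat{\mathcal A}_*^{D-1}$. Ties are broken arbitrarily. **Theorem.** Let $B_{T,\delta}=\sqrt{1+2\log(AD\sqrt T/\delta)}$. 1. If PF-LEX is run with $\delta\in(0,1)$ and $\epsilon>0$, then with probability at least $1-\delta$, for all objectives $i$ and all $T\ge1$, $$\mathrm{Reg}_{pb}^i(T)\le 4\sqrt2\,B_{T,\delta}\sqrt{|\mathcal S_*^i|T}+\Big(3+\frac{16}{\epsilon^2}\log\frac{2\sqrt e\,AD}{\epsilon\delta}\Big)|\mathcal S_*^i|\Delta_{\max}^i+\epsilon(A-1)T .$$ 2. If, for a given horizon $T\ge1$, PF-LEX is run with $\delta\in(0,1)$ and $\epsilon=T^{-1/3}$, then with probability at least $1-\delta$, for all $i$, $$\mathrm{Reg}_{pb}^i(T)\le 4\sqrt2\,B_{T,\delta}\sqrt{|\mathcal S_*^i|T}+\Big(3+16T^{2/3}\log\frac{2\sqrt e\,AD\,T^{1/3}}{\delta}\Big)|\mathcal S_*^i|\Delta_{\max}^i+(A-1)T^{2/3}.$$ 3. If, for a given horizon $T$, PF-LEX is run with $\epsilon=T^{-1/3}$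 and $\delta=1/T$, then $\mathbb E[\mathrm{Reg}_{pb}^i(T)]=\tilde O(T^{2/3})$: for every $M$ there are constants $C$ and $k$, depending only on $A$, $D$ and $M$, such that for all $T\ge2$, all instances with $A$ arms and $D$ objectives, and all objectives $i$ with $\Delta_{\max}^i\le M$, $\mathbb E[\mathrm{Reg}_{pb}^i(T)]\le C\,T^{2/3}(\log T)^k$. -/

import Mathlib

open MeasureTheory ProbabilityTheory

/-- `x` lexicographically dominates `y` in the first `i` objectives (objectives are numbered
`0, …, D - 1`): at the first of these objectives in which they differ, `x` is larger. -/
def LexDominates {D : ℕ} (i : ℕ) (x y : Fin D → ℝ) : Prop :=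
  ∃ j : Fin D, (j : ℕ) < i ∧ (∀ k < j, x k = y k) ∧ y j < x j

/-- A stochastic multiobjective bandit with `A` arms and `D` lexicographically ordered objectives:
expected rewards, and for every arm the joint law of the noise vector, whose marginals have mean
zero and are 1-sub-Gaussian. -/
structure LexBandit (A D : ℕ) where
  mean : Fin A → Fin D → ℝ
  noise : Fin A → Measure (Fin D → ℝ)
  isProbabilityMeasure_noise : ∀ a, IsProbabilityMeasure (noise a)
  noise_mean : ∀ a i, ∫ x, x i ∂(noise a) = 0
  noise_subgaussian : ∀ a i, HasSubgaussianMGF (fun x : Fin D → ℝ => x i) 1 (noise a)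

namespace LexBandit

variable {A D : ℕ}

/-- The arms that are lexicographic optimal in the first `i` objectives (all arms if `i = 0`). -/
def optArms (E : LexBandit A D) (i : ℕ) : Set (Fin A) :=
  {a | ∀ a', ¬ LexDominates i (E.mean a') (E.mean a)}

theorem optArms_nonempty [NeZero A] (E : LexBandit A D) (i : ℕ) : (E.optArms i).Nonempty := by
  obtain ⟨a, ha⟩ := Finite.exists_max (fun a : Fin A => toLex (E.mean a))
  refine ⟨a, fun a' ⟨j, _, hlt, hj⟩ => ?_⟩
  have h : toLex (E.mean a) < toLex (E.mean a') := ⟨j, fun k hk => (hlt k hk).symm, hj⟩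
  exact absurd (ha a') (not_le.mpr h)

/-- An arm that is lexicographic optimal in all objectives. All such arms have the same expected
reward vector. -/
noncomputable def star [NeZero A] (E : LexBandit A D) : Fin A :=
  (E.optArms_nonempty D).choose

/-- The gap of arm `a` in objective `i`. -/
noncomputable def gap [NeZero A] (E : LexBandit A D) (i : Fin D) (a : Fin A) : ℝ :=
  E.mean E.star i - E.mean a i

/-- The largest gap in objective `i`. -/
noncomputable def gapMax [NeZero A] (E : LexBandit A D) (i : Fin D) : ℝ :=
  Finset.univ.sup' Finset.univ_nonempty (E.gap i)

/-- The arms that are lexicographic optimal in the objectives before `i`, but not in the objectives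
up to and including `i`. -/
def subopt (E : LexBandit A D) (i : Fin D) : Set (Fin A) :=
  E.optArms i \ E.optArms (i + 1)

open Classical in
/-- The priority-based regret in objective `i` of the first `T` selections of `a`. -/
noncomputable def regret [NeZero A] (E : LexBandit A D) (i : Fin D) (T : ℕ) (a : ℕ → Fin A) : ℝ :=
  ∑ t ∈ Finset.range T, if a t ∈ E.subopt i then E.gap i (a t) else 0

/-- The law of the reward vector `mean a + noise` of arm `a`, as a kernel. -/
noncomputable def rewardKernel (E : LexBandit A D) : Kernel (Fin A) (Fin D → ℝ) :=
  Kernel.ofFunOfCountable fun a => (E.noise a).map fun x => E.mean a + x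

instance (E : LexBandit A D) : IsMarkovKernel E.rewardKernel :=
  ⟨fun a => by
    have := E.isProbabilityMeasure_noise a
    exact Measure.isProbabilityMeasure_map (by fun_prop)⟩

end LexBandit

/-- What a learner has seen after `t` rounds: the selected arms and the reward vectors. -/
abbrev History (A D t : ℕ) : Type := Fin t → Fin A × (Fin D → ℝ)

/-- The random history of the first `t` rounds. Rounds are numbered from `0`. -/
def history {A D : ℕ} {Ω : Type*} (a : ℕ → Ω → Fin A) (r : ℕ → Ω → Fin D → ℝ) (t : ℕ) (ω : Ω) :
    History A D t :=
  fun s => (a s ω, r s ω)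

/-- The selected arms `a` and the observed reward vectors `r` arise from running the (randomized)
policy `π` in the bandit `E`: given the past, the arm is drawn from `π`, and given the past and the
arm, the reward vector is drawn from the reward law of this arm. -/
structure LexBandit.IsInteraction {A D : ℕ} (E : LexBandit A D)
    (π : (t : ℕ) → Kernel (History A D t) (Fin A)) {Ω : Type*} [MeasurableSpace Ω] (P : Measure Ω)
    (a : ℕ → Ω → Fin A) (r : ℕ → Ω → Fin D → ℝ) : Prop where
  measurable_arm : ∀ t, Measurable (a t)
  measurable_reward : ∀ t, Measurable (r t)
  arm_law : ∀ t, HasCondDistrib (a t) (history a r t) (π t) P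
  reward_law : ∀ t, HasCondDistrib (r t) (fun ω => (history a r t ω, a t ω))
    (Kernel.prodMkLeft (History A D t) E.rewardKernel) P

namespace PFLEX

variable {A D t : ℕ}

/-- The number of past selections of arm `a`. -/
def count (h : History A D t) (a : Fin A) : ℕ :=
  (Finset.univ.filter fun s => (h s).1 = a).card

/-- The sample mean of the rewards of arm `a` in objective `i` (`0` if `a` was never selected). -/
noncomputable def sampleMean (h : History A D t) (a : Fin A) (i : Fin D) : ℝ :=
  (∑ s, if (h s).1 = a then (h s).2 i else 0) / count h a

/-- Half of the length of the confidence interval of arm `a`, infinite if `a` was never selected. -/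
noncomputable def radius (δ : ℝ) (h : History A D t) (a : Fin A) : EReal :=
  if count h a = 0 then ⊤ else
    ((√((1 + count h a : ℝ) / (count h a : ℝ) ^ 2 *
      (1 + 2 * Real.log ((A : ℝ) * D * √(1 + count h a : ℝ) / δ))) : ℝ) : EReal)

/-- Upper confidence bound. -/
noncomputable def ucb (δ : ℝ) (h : History A D t) (a : Fin A) (i : Fin D) : EReal :=
  (sampleMean h a i : EReal) + radius δ h a

/-- Lower confidence bound. -/
noncomputable def lcb (δ : ℝ) (h : History A D t) (a : Fin A) (i : Fin D) : EReal :=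
  (sampleMean h a i : EReal) - radius δ h a

/-- Two arms are linked in objective `i` if their confidence intervals intersect. -/
def Linked (δ : ℝ) (h : History A D t) (i : Fin D) (a b : Fin A) : Prop :=
  (Set.Icc (lcb δ h a i) (ucb δ h a i) ∩ Set.Icc (lcb δ h b i) (ucb δ h b i)).Nonempty

/-- Two arms are chained in objective `i` within the set `S` of candidate arms if they are related
by the transitive closure of the linked relation on `S`. -/
def Chained (δ : ℝ) (h : History A D t) (i : Fin D) (S : Set (Fin A)) : Fin A → Fin A → Prop :=
  Relation.TransGen fun a b => a ∈ S ∧ b ∈ S ∧ Linked δ h i a b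

/-- `b` maximizes the upper confidence bound in objective `i` over the set `S`. -/
def IsOptimistic (δ : ℝ) (h : History A D t) (i : Fin D) (S : Set (Fin A)) (b : Fin A) : Prop :=
  b ∈ S ∧ ∀ c ∈ S, ucb δ h c i ≤ ucb δ h b i

/-- The estimated set of arms that are near-lexicographic optimal in the first `j` objectives
(meant for `j ≤ D`). All maximizers of the upper confidence bound are linked to each other, so that
the set does not depend on how ties between them are broken. -/
def nearOpt (δ : ℝ) (h : History A D t) : ℕ → Set (Fin A)
  | 0 => Set.univ
  | j + 1 => {a | a ∈ nearOpt δ h j ∧ ∀ i : Fin D, (i : ℕ) = j →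
      ∃ b, IsOptimistic δ h i (nearOpt δ h j) b ∧ Chained δ h i (nearOpt δ h j) a b}

/-- The candidate arms after the first objective whose uncertainty is still high. -/
def explore (ε δ : ℝ) (h : History A D t) : Set (Fin A) :=
  {a | a ∈ nearOpt δ h 1 ∧ ((ε / 2 : ℝ) : EReal) < radius δ h a}

/-- The maximizers of the upper confidence bound in the last objective over the arms that are
estimated to be near-lexicographic optimal in the other objectives. -/
def exploit [NeZero D] (δ : ℝ) (h : History A D t) : Set (Fin A) :=
  {b | IsOptimistic δ h ⟨D - 1, Nat.sub_one_lt (NeZero.ne D)⟩ (nearOpt δ h (D - 1)) b}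

/-- The policy `π` is PF-LEX with parameters `ε` and `δ`: if there are candidate arms with high
uncertainty, one of them is selected uniformly at random, otherwise an optimistic arm is selected,
with an arbitrary rule for breaking ties. -/
structure IsPolicy [NeZero D] (ε δ : ℝ) (π : (t : ℕ) → Kernel (History A D t) (Fin A)) :
    Prop where
  isMarkovKernel : ∀ t, IsMarkovKernel (π t)
  uniform : ∀ t (h : History A D t), (explore ε δ h).Nonempty →
    π t h = uniformOn (explore ε δ h)
  optimistic : ∀ t (h : History A D t), ¬ (explore ε δ h).Nonempty → π t h (exploit δ h) = 1

end PFLEX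

/-! The proof separates a deterministic regret bound, on the event that every confidence interval
always contains its mean, from a bound on the probability of that event.

On this event an exploited arm `a` survives all filters (`Valid.exploit_subset`). The optimal arm
itself may be filtered out, since an arm slightly worse in an early objective can be far better in a
later one. But objective `i` is charged only when `a` ties with the optimal arm in all objectives
before `i`, and ties keep the two together through these filters (`Valid.mem_nearOpt_of_mean_eq`).
At stage `i`, `a` is then joined by a chain to an arm whose upper bound is at least the optimal
mean. Outside exploration all widths on the chain are at most `ε / 2`, so each of its at most `A -
1` links changes the upper bound by at most `ε`, whence a gap of at most `ε (A - 1)` plus twice the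
width of `a` (`Valid.gap_le`). Summing over rounds, the widths telescope to square roots of counts,
and exploration of an arm stops after about `ε⁻² log (1 / (ε δ))` selections
(`succ_le_of_lt_width`).

The event has probability at least `1 - δ`: the exponential supermartingale of the noise sum, mixed
over its parameter by a standard Gaussian, has a closed form, and the maximal inequality at level `A
D / δ` with a union bound over arms and objectives yields exactly the widths of the algorithm. -/

open scoped ENNReal NNReal

/-! ### Chains of linked arms and the gap of an exploited arm -/

/-- If consecutive values along a chain differ by at most `ε`, then the values at its ends differ by
at most `ε` times the largest possible length of a simple path. -/
theorem abs_sub_le_of_reflTransGen {V : Type*} [Fintype V] {ε : ℝ} (hε : 0 ≤ ε) (f : V → ℝ) {x y : V}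
    (h : Relation.ReflTransGen (fun x y => |f x - f y| ≤ ε) x y) :
    |f x - f y| ≤ ε * ((Fintype.card V : ℝ) - 1) := by
  classical
  let G : SimpleGraph V :=
    { Adj := fun x y => x ≠ y ∧ |f x - f y| ≤ ε
      symm := ⟨fun x y h => ⟨h.1.symm, by rw [abs_sub_comm]; exact h.2⟩⟩
      loopless := ⟨fun x h => h.1 rfl⟩ }
  have hreach : G.Reachable x y := by
    induction h with
    | refl => exact SimpleGraph.Reachable.refl _
    | @tail b c _ hbc ih =>
      by_cases hne : b = c
      · exact hne ▸ ih
      · exact ih.trans (SimpleGraph.Adj.reachable (G := G) ⟨hne, hbc⟩)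
  have hwalk : ∀ {u v : V} (p : G.Walk u v), |f u - f v| ≤ ε * p.length := by
    intro u v p
    induction p with
    | nil => simp
    | @cons u v w hadj p ih =>
      have h1 := hadj.2
      have h2 : |f u - f w| ≤ |f u - f v| + |f v - f w| := abs_sub_le _ _ _
      rw [SimpleGraph.Walk.length_cons]
      push_cast
      linarith
  obtain ⟨p⟩ := hreach
  -- Cutting out cycles leaves a path without repeated vertices, hence with at most `card V - 1`
  -- edges.
  have hp := (p.bypass_isPath).length_lt
  have hp' : (p.bypass.length : ℝ) + 1 ≤ Fintype.card V := by exact_mod_cast hp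
  refine (hwalk p.bypass).trans (mul_le_mul_of_nonneg_left (by linarith) hε)

namespace LexBandit

variable {A D : ℕ} [NeZero A]

/-- At the first objective before `i` where the two mean vectors differed, one of the arms would
dominate the other, against the optimality of both. -/
theorem mean_eq_star_of_mem_optArms (E : LexBandit A D) {i : ℕ} {a : Fin A} (ha : a ∈ E.optArms i)
    (k : Fin D) (hk : (k : ℕ) < i) : E.mean a k = E.mean E.star k := by
  have hstar : E.star ∈ E.optArms D := (E.optArms_nonempty D).choose_spec
  induction k using WellFoundedLT.induction with
  | ind k ih =>
    rcases lt_trichotomy (E.mean a k) (E.mean E.star k) with h | h | h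
    · exact absurd ⟨k, hk, fun l hl => (ih l hl (lt_trans hl hk)).symm, h⟩ (ha E.star)
    · exact h
    · exact absurd ⟨k, k.2, fun l hl => ih l hl (lt_trans hl hk), h⟩ (hstar a)

theorem gap_le_gapMax (E : LexBandit A D) (i : Fin D) (a : Fin A) : E.gap i a ≤ E.gapMax i :=
  Finset.le_sup' (E.gap i) (Finset.mem_univ a)

theorem gapMax_nonneg (E : LexBandit A D) (i : Fin D) : 0 ≤ E.gapMax i := by
  have h := E.gap_le_gapMax i E.star
  simpa [gap] using h

end LexBandit

namespace PFLEX

variable {A D t : ℕ}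

/-- The real number that `radius` is equal to for an arm with at least one selection. -/
noncomputable def width (A D : ℕ) (δ : ℝ) (n : ℕ) : ℝ :=
  √((1 + n : ℝ) / (n : ℝ) ^ 2 * (1 + 2 * Real.log ((A : ℝ) * D * √(1 + n : ℝ) / δ)))

theorem radius_eq_width {δ : ℝ} {h : History A D t} {a : Fin A} (ha : count h a ≠ 0) :
    radius δ h a = (width A D δ (count h a) : EReal) := by
  simp [radius, width, ha]

theorem radius_eq_top {δ : ℝ} {h : History A D t} {a : Fin A} (ha : count h a = 0) :
    radius δ h a = ⊤ := by
  simp [radius, ha]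

/-- All confidence intervals contain the expected rewards. -/
def Valid (E : LexBandit A D) (δ : ℝ) (h : History A D t) : Prop :=
  ∀ a i, count h a ≠ 0 → |sampleMean h a i - E.mean a i| ≤ width A D δ (count h a)

theorem Valid.mean_mem {E : LexBandit A D} {δ : ℝ} {h : History A D t} (hv : Valid E δ h)
    (a : Fin A) (i : Fin D) : (E.mean a i : EReal) ∈ Set.Icc (lcb δ h a i) (ucb δ h a i) := by
  by_cases ha : count h a = 0
  · simp [lcb, ucb, radius_eq_top ha]
  · have h1 := abs_le.mp (hv a i ha)
    rw [lcb, ucb, radius_eq_width ha, ← EReal.coe_sub, ← EReal.coe_add]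
    constructor <;> rw [EReal.coe_le_coe_iff] <;> linarith [h1.1, h1.2]

theorem Valid.linked_of_mean_eq {E : LexBandit A D} {δ : ℝ} {h : History A D t} (hv : Valid E δ h)
    {a b : Fin A} {i : Fin D} (hab : E.mean a i = E.mean b i) : Linked δ h i a b :=
  ⟨E.mean a i, hv.mean_mem a i, by rw [hab]; exact hv.mean_mem b i⟩

theorem nearOpt_antitone (δ : ℝ) (h : History A D t) : Antitone (nearOpt δ h) :=
  antitone_nat_of_succ_le fun _ _ ha => ha.1

/-- Valid intervals of arms with a common mean meet in that mean, so any chain starting at `a`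
extends to one starting at `b`. This is how the optimal arm is kept alongside an arm that ties with
it. -/
theorem Valid.mem_nearOpt_of_mean_eq {E : LexBandit A D} {δ : ℝ} {h : History A D t}
    (hv : Valid E δ h) {a b : Fin A} (j : ℕ) (hab : ∀ k : Fin D, (k : ℕ) < j → E.mean a k = E.mean b k)
    (ha : a ∈ nearOpt δ h j) : b ∈ nearOpt δ h j := by
  induction j with
  | zero => exact Set.mem_univ b
  | succ j ih =>
    have hb := ih (fun k hk => hab k (by omega)) ha.1
    refine ⟨hb, fun i hi => ?_⟩
    obtain ⟨c, hc, hch⟩ := ha.2 i hi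
    exact ⟨c, hc, Relation.TransGen.head
      ⟨hb, ha.1, hv.linked_of_mean_eq (hab i (by omega)).symm⟩ hch⟩

theorem Valid.chained_self {E : LexBandit A D} {δ : ℝ} {h : History A D t} (hv : Valid E δ h)
    {S : Set (Fin A)} {i : Fin D} {b : Fin A} (hb : b ∈ S) : Chained δ h i S b b :=
  Relation.TransGen.single ⟨hb, hb, hv.linked_of_mean_eq rfl⟩

/-- The policy maximizes over the candidates of stage `D - 1`. The maximizer passes the last filter
as well, because it is linked to itself. -/
theorem Valid.exploit_subset [NeZero D] {E : LexBandit A D} {δ : ℝ} {h : History A D t}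
    (hv : Valid E δ h) : exploit δ h ⊆ nearOpt δ h D := by
  intro b hb
  have h1 : b ∈ nearOpt δ h (D - 1 + 1) := by
    refine ⟨hb.1, fun i hi => ⟨b, ?_, hv.chained_self hb.1⟩⟩
    have : i = ⟨D - 1, Nat.sub_one_lt (NeZero.ne D)⟩ := Fin.ext hi
    rw [this]
    exact hb
  rwa [Nat.sub_add_cancel (NeZero.one_le)] at h1

theorem radius_le_of_not_explore {ε δ : ℝ} {h : History A D t} (he : ¬ (explore ε δ h).Nonempty)
    {a : Fin A} (ha : a ∈ nearOpt δ h 1) :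
    count h a ≠ 0 ∧ width A D δ (count h a) ≤ ε / 2 := by
  have h1 : radius δ h a ≤ ((ε / 2 : ℝ) : EReal) := by
    by_contra hlt
    exact he ⟨a, ha, not_le.mp hlt⟩
  by_cases hc : count h a = 0
  · rw [radius_eq_top hc] at h1
    exact absurd h1 (by simp)
  · rw [radius_eq_width hc] at h1
    exact ⟨hc, EReal.coe_le_coe_iff.mp h1⟩

/-- If the lower bound of `a` is at most the upper bound of `b`, then the upper bound of `a` exceeds
that of `b` by at most the length of the interval of `a`, which is at most `ε`. Comparing upper
bounds instead of centres makes a link cost one interval length. -/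
theorem Linked.abs_sub_le {ε δ : ℝ} {h : History A D t} {i : Fin D} {a b : Fin A}
    (hl : Linked δ h i a b) (ha : count h a ≠ 0) (hb : count h b ≠ 0)
    (hwa : width A D δ (count h a) ≤ ε / 2) (hwb : width A D δ (count h b) ≤ ε / 2) :
    |(sampleMean h a i + width A D δ (count h a)) - (sampleMean h b i + width A D δ (count h b))|
      ≤ ε := by
  obtain ⟨z, ⟨h1, h2⟩, h3, h4⟩ := hl
  have h5 := h1.trans h4
  have h6 := h3.trans h2
  simp only [lcb, ucb, radius_eq_width ha, radius_eq_width hb, ← EReal.coe_sub, ← EReal.coe_add,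
    EReal.coe_le_coe_iff] at h5 h6
  rw [abs_le]
  constructor <;> linarith

/-- An arm that is selected in the exploitation phase and that is lexicographic optimal in the
objectives before `i` has a small gap in objective `i`. -/
theorem Valid.gap_le [NeZero A] [NeZero D] {E : LexBandit A D} {ε δ : ℝ} {h : History A D t}
    (hv : Valid E δ h) (hε : 0 ≤ ε) (he : ¬ (explore ε δ h).Nonempty) {a : Fin A}
    (ha : a ∈ exploit δ h) {i : Fin D} (hi : a ∈ E.optArms i) :
    count h a ≠ 0 ∧ E.gap i a ≤ ε * ((A : ℝ) - 1) + 2 * width A D δ (count h a) := by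
  have hD := hv.exploit_subset ha
  have hai : a ∈ nearOpt δ h (i + 1) := nearOpt_antitone δ h (Nat.succ_le_of_lt i.2) hD
  have hsub : nearOpt δ h (i + 1) ⊆ nearOpt δ h 1 := nearOpt_antitone δ h (by omega)
  have hstar : E.star ∈ nearOpt δ h i := hv.mem_nearOpt_of_mean_eq i
    (fun k hk => E.mean_eq_star_of_mem_optArms hi k hk) hai.1
  obtain ⟨b, hb, hch⟩ := hai.2 i rfl
  -- Every arm on the chain is itself chained to `b`, so it passes filter `i`, belongs to `nearOpt δ
  -- h 1`, and has width at most `ε / 2`.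
  have hmem : ∀ {x}, x ∈ nearOpt δ h i → Chained δ h i (nearOpt δ h i) x b →
      x ∈ nearOpt δ h (i + 1) := by
    intro x hx hxb
    refine ⟨hx, fun k hk => ?_⟩
    obtain rfl : k = i := Fin.ext hk
    exact ⟨b, hb, hxb⟩
  have hbi : b ∈ nearOpt δ h (i + 1) := hmem hb.1 (hv.chained_self hb.1)
  obtain ⟨hca, hwa⟩ := radius_le_of_not_explore he (hsub hai)
  obtain ⟨hcb, hwb⟩ := radius_le_of_not_explore he (hsub hbi)
  have hstep : ∀ {x y}, x ∈ nearOpt δ h (i + 1) → y ∈ nearOpt δ h (i + 1) → Linked δ h i x y →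
      |(sampleMean h x i + width A D δ (count h x)) -
        (sampleMean h y i + width A D δ (count h y))| ≤ ε := by
    intro x y hx hy hl
    obtain ⟨h1, h2⟩ := radius_le_of_not_explore he (hsub hx)
    obtain ⟨h3, h4⟩ := radius_le_of_not_explore he (hsub hy)
    exact hl.abs_sub_le h1 h3 h2 h4
  have hR : Relation.ReflTransGen
      (fun x y => |(sampleMean h x i + width A D δ (count h x)) -
        (sampleMean h y i + width A D δ (count h y))| ≤ ε) a b := by
    clear hai hca hwa hi hD ha
    have hch' := hch
    unfold Chained at hch'
    induction hch' using Relation.TransGen.head_induction_on with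
    | @single x hx =>
      exact Relation.ReflTransGen.single
        (hstep (hmem hx.1 (Relation.TransGen.single hx)) hbi hx.2.2)
    | @head x y hxy hyb ih =>
      exact Relation.ReflTransGen.head
        (hstep (hmem hxy.1 (Relation.TransGen.head hxy hyb)) (hmem hxy.2.1 hyb) hxy.2.2)
        (ih hyb)
  have hchain := abs_sub_le_of_reflTransGen hε
    (fun x => sampleMean h x i + width A D δ (count h x)) hR
  -- The optimal mean is below the upper bound of the optimal arm, hence below that of the maximizer
  -- `b`. The chain carries this to `a`, whose upper bound exceeds its mean by at most two widths.
  have h1 : (E.mean E.star i : EReal) ≤ ucb δ h b i :=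
    (hv.mean_mem E.star i).2.trans (hb.2 _ hstar)
  rw [ucb, radius_eq_width hcb, ← EReal.coe_add, EReal.coe_le_coe_iff] at h1
  have h2 := (abs_le.mp (hv a i hca)).2
  have h3 := (abs_le.mp hchain).1
  rw [Fintype.card_fin] at h3
  refine ⟨hca, ?_⟩
  rw [LexBandit.gap]
  linarith

end PFLEX

/-! ### Deterministic regret bound: number of explorations and sum of widths -/

namespace PFLEX

variable {A D : ℕ}

theorem one_le_confidence_ratio [NeZero A] [NeZero D] {δ : ℝ} (hδ : 0 < δ) (hδ1 : δ < 1) :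
    1 ≤ (A : ℝ) * D / δ := by
  have hA : (1 : ℝ) ≤ A := by exact_mod_cast NeZero.one_le
  have hD : (1 : ℝ) ≤ D := by exact_mod_cast NeZero.one_le
  rw [le_div_iff₀ hδ]
  nlinarith

theorem log_confidence [NeZero A] [NeZero D] {δ y : ℝ} (hδ : 0 < δ) (hδ1 : δ < 1) (hy : 0 < y) :
    Real.log ((A : ℝ) * D * √y / δ) = Real.log ((A : ℝ) * D / δ) + Real.log y / 2 := by
  have h := one_le_confidence_ratio (A := A) (D := D) hδ hδ1
  rw [← Real.log_sqrt hy.le, ← Real.log_mul (by positivity) (by positivity)]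
  congr 1
  ring

theorem width_le [NeZero A] [NeZero D] {δ : ℝ} (hδ : 0 < δ) (hδ1 : δ < 1) {n T : ℕ} (hn : n ≠ 0)
    (hT : n + 1 ≤ T) :
    width A D δ n ≤ √2 * √(1 + 2 * Real.log ((A : ℝ) * D * √(T : ℝ) / δ)) * (1 / √(n : ℝ)) := by
  have hn' : (1 : ℝ) ≤ n := by exact_mod_cast Nat.one_le_iff_ne_zero.mpr hn
  have hT' : (1 : ℝ) + n ≤ T := by rw [add_comm]; exact_mod_cast hT
  have hL := Real.log_nonneg (one_le_confidence_ratio (A := A) (D := D) hδ hδ1)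
  have hlog : Real.log (1 + n : ℝ) ≤ Real.log T := Real.log_le_log (by linarith) hT'
  have hlog0 : 0 ≤ Real.log (1 + n : ℝ) := Real.log_nonneg (by linarith)
  rw [width, log_confidence hδ hδ1 (by linarith), log_confidence hδ hδ1 (by linarith),
    ← Real.sqrt_mul (by norm_num), one_div, ← Real.sqrt_inv, ← Real.sqrt_mul (by positivity)]
  refine Real.sqrt_le_sqrt ?_
  have h1 : (1 + n : ℝ) / (n : ℝ) ^ 2 ≤ 2 * (n : ℝ)⁻¹ := by
    rw [← div_eq_mul_inv, div_le_div_iff₀ (by positivity) (by positivity)]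
    nlinarith
  calc _ ≤ 2 * (n : ℝ)⁻¹ * (1 + 2 * (Real.log ((A : ℝ) * D / δ) + Real.log T / 2)) := by
        apply mul_le_mul h1 (by linarith) (by linarith) (by positivity)
    _ = _ := by ring

/-- An arm that is still explored after `n` selections has not been selected too often. -/
theorem succ_le_of_lt_width [NeZero A] [NeZero D] {ε δ : ℝ} (hε : 0 < ε) (hδ : 0 < δ) (hδ1 : δ < 1)
    {n : ℕ} (hn : n = 0 ∨ ε / 2 < width A D δ n) :
    (n : ℝ) + 1 ≤ 3 + 16 / ε ^ 2 * Real.log (2 * √(Real.exp 1) * A * D / (ε * δ)) := by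
  have hK := one_le_confidence_ratio (A := A) (D := D) hδ hδ1
  set L := Real.log ((A : ℝ) * D / δ) with hLdef
  have hL : 0 ≤ L := Real.log_nonneg hK
  -- With `x = (ε / 2) ^ 2`, the logarithm in the claim is half of `W = 1 + 2 L - log x`, and the
  -- claim becomes `(n - 2) x ≤ 2 W`.
  obtain ⟨x, hx⟩ : ∃ x, x = ε ^ 2 / 4 := ⟨_, rfl⟩
  have hx0 : 0 < x := by rw [hx]; positivity
  have hQ : Real.log (2 * √(Real.exp 1) * A * D / (ε * δ)) = (1 + 2 * L - Real.log x) / 2 := by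
    have e1 : 2 * √(Real.exp 1) * A * D / (ε * δ) = √(Real.exp 1) * ((A : ℝ) * D / δ) / √x := by
      have : √x = ε / 2 := by
        rw [hx, show ε ^ 2 / 4 = (ε / 2) ^ 2 by ring, Real.sqrt_sq (by positivity)]
      rw [this]
      field_simp
    rw [e1, Real.log_div (by positivity) (by positivity), Real.log_mul (by positivity) (by positivity),
      Real.log_sqrt (by positivity), Real.log_sqrt hx0.le, Real.log_exp]
    ring
  have h16 : 16 / ε ^ 2 = 4 / x := by
    rw [hx]; field_simp; norm_num
  rw [hQ, h16]
  set W := 1 + 2 * L - Real.log x with hW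
  suffices h : ((n : ℝ) - 2) * x ≤ 2 * W by
    have h2 : (n : ℝ) - 2 ≤ 2 * W / x := by rwa [le_div_iff₀ hx0]
    have h3 : 4 / x * (W / 2) = 2 * W / x := by ring
    rw [h3]
    linarith
  rcases Nat.eq_zero_or_pos n with h0 | h0
  · have := Real.log_le_sub_one_of_pos hx0
    subst h0
    push_cast
    linarith
  · have hw := hn.resolve_left h0.ne'
    have hn1 : (1 : ℝ) ≤ n := by exact_mod_cast h0
    rw [width, Real.lt_sqrt (by positivity), log_confidence hδ hδ1 (by linarith)] at hw
    have hw2 : x * n ^ 2 < (1 + n) * (1 + 2 * L + Real.log (1 + n)) := by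
      have e : (1 + n : ℝ) / (n : ℝ) ^ 2 * (1 + 2 * (L + Real.log (1 + n) / 2)) =
          (1 + n) * (1 + 2 * L + Real.log (1 + n)) / (n : ℝ) ^ 2 := by ring
      rw [e, lt_div_iff₀ (by positivity)] at hw
      calc x * n ^ 2 = (ε / 2) ^ 2 * n ^ 2 := by rw [hx]; ring
        _ < _ := hw
    -- The tangent bound `log z ≤ z / e` at `z = x (1 + n)`, with `1 / e ≤ 0.368`. It trades the
    -- implicit `log (1 + n)` for `- log x` and a small multiple of `x (1 + n)`.
    have he : Real.log (1 + n : ℝ) ≤ x * (1 + n) * 0.368 - Real.log x := by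
      have h1 := Real.log_le_sub_one_of_pos (x := x * (1 + n) / Real.exp 1) (by positivity)
      rw [Real.log_div (by positivity) (by positivity), Real.log_mul (by positivity) (by positivity),
        Real.log_exp] at h1
      have h2 : x * (1 + n) / Real.exp 1 ≤ x * (1 + n) * 0.368 := by
        rw [div_le_iff₀ (Real.exp_pos 1), mul_assoc]
        have := Real.exp_one_gt_d9
        exact le_mul_of_one_le_right (by positivity) (by nlinarith)
      linarith
    have h3 : x * n ^ 2 < (1 + n) * (W + x * (1 + n) * 0.368) :=
      hw2.trans_le (mul_le_mul_of_nonneg_left (by rw [hW]; linarith) (by linarith))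
    have h4 : (1 + n : ℝ) * ((n - 2) * x) ≤ (1 + n) * (2 * W) := by
      -- The bracket is `0.264 n² - 0.472 n + 1.264`, which has negative discriminant. The `- 2` in
      -- the target leaves this room.
      have h5 : 0 ≤ x * (2 * n ^ 2 - 2 * 0.368 * (1 + n) ^ 2 - (1 + n) * ((n : ℝ) - 2)) :=
        mul_nonneg hx0.le (by nlinarith [sq_nonneg ((n : ℝ) - 1)])
      linarith
    exact le_of_mul_le_mul_left h4 (by linarith)

theorem count_succ {Ω : Type*} (a : ℕ → Ω → Fin A) (r : ℕ → Ω → Fin D → ℝ) (t : ℕ) (ω : Ω)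
    (b : Fin A) : count (history a r (t + 1) ω) b =
      count (history a r t ω) b + if a t ω = b then 1 else 0 := by
  unfold count
  rw [Finset.card_filter, Finset.card_filter, Fin.sum_univ_castSucc]
  rfl

theorem sum_count {Ω : Type*} (a : ℕ → Ω → Fin A) (r : ℕ → Ω → Fin D → ℝ) (t : ℕ) (ω : Ω) :
    ∑ b, count (history a r t ω) b = t := by
  simpa [count] using (Finset.card_eq_sum_card_fiberwise (s := (Finset.univ : Finset (Fin t)))
    (f := fun s => (history a r t ω s).1) (t := Finset.univ) (by simp)).symm

theorem count_le {Ω : Type*} (a : ℕ → Ω → Fin A) (r : ℕ → Ω → Fin D → ℝ) (t : ℕ) (ω : Ω)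
    (b : Fin A) : count (history a r t ω) b ≤ t := by
  simpa [count] using Finset.card_filter_le (Finset.univ : Finset (Fin t))
    fun s => (history a r t ω s).1 = b

/-- The arm that is selected after the history `h` is one that PF-LEX may select. -/
def Follows [NeZero D] {t : ℕ} (ε δ : ℝ) (h : History A D t) (b : Fin A) : Prop :=
  ((explore ε δ h).Nonempty → b ∈ explore ε δ h) ∧ (¬ (explore ε δ h).Nonempty → b ∈ exploit δ h)

theorem lt_width_of_mem_explore {t : ℕ} {ε δ : ℝ} {h : History A D t} {b : Fin A}
    (hb : b ∈ explore ε δ h) : count h b = 0 ∨ ε / 2 < width A D δ (count h b) := by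
  by_cases hc : count h b = 0
  · exact Or.inl hc
  · have := hb.2
    rw [radius_eq_width hc, EReal.coe_lt_coe_iff] at this
    exact Or.inr this

/-- Equivalent to `(√n - √(n - 1))² ≥ 0`; it makes the sum of the widths telescope. -/
theorem one_div_sqrt_le {n : ℕ} (hn : n ≠ 0) :
    1 / √(n : ℝ) ≤ 2 * (√(n : ℝ) - √((n - 1 : ℕ) : ℝ)) := by
  have hn1 : 1 ≤ n := Nat.one_le_iff_ne_zero.mpr hn
  have hn' : (1 : ℝ) ≤ n := by exact_mod_cast hn1
  have h1 : (0 : ℝ) < √(n : ℝ) := Real.sqrt_pos.mpr (by linarith)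
  rw [div_le_iff₀ h1]
  have h2 : √(n : ℝ) ^ 2 = n := Real.sq_sqrt (by linarith)
  have h3 : √((n - 1 : ℕ) : ℝ) ^ 2 = n - 1 := by
    rw [Real.sq_sqrt (by positivity), Nat.cast_sub hn1, Nat.cast_one]
  nlinarith [sq_nonneg (√(n : ℝ) - √((n - 1 : ℕ) : ℝ))]

/-- The regret that the selections of one arm cause. -/
theorem arm_regret_le [NeZero A] [NeZero D] {Ω : Type*} {a : ℕ → Ω → Fin A}
    {r : ℕ → Ω → Fin D → ℝ} {ω : Ω} {E : LexBandit A D} {ε δ : ℝ} (hε : 0 < ε) (hδ : 0 < δ)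
    (hδ1 : δ < 1) (hv : ∀ t, Valid E δ (history a r t ω))
    (hf : ∀ t, Follows ε δ (history a r t ω) (a t ω)) {i : Fin D} {b : Fin A}
    (hb : b ∈ E.optArms i) (T : ℕ) :
    (∑ t ∈ Finset.range T, if a t ω = b then E.gap i b else 0) ≤
      (3 + 16 / ε ^ 2 * Real.log (2 * √(Real.exp 1) * A * D / (ε * δ))) * E.gapMax i
        + ε * ((A : ℝ) - 1) * count (history a r T ω) b
        + 4 * √2 * √(1 + 2 * Real.log ((A : ℝ) * D * √(T : ℝ) / δ)) *
          √(count (history a r T ω) b : ℝ) := by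
  set Q := 3 + 16 / ε ^ 2 * Real.log (2 * √(Real.exp 1) * A * D / (ε * δ))
  set B := √(1 + 2 * Real.log ((A : ℝ) * D * √(T : ℝ) / δ))
  have hA : 0 ≤ ε * ((A : ℝ) - 1) := by
    have hA : (1 : ℝ) ≤ A := by exact_mod_cast NeZero.one_le
    exact mul_nonneg hε.le (by linarith)
  have hB : 0 ≤ 4 * √2 * B := by positivity
  have hQ : ∀ n : ℕ, (n = 0 ∨ ε / 2 < width A D δ n) → (n : ℝ) + 1 ≤ Q :=
    fun n hn => succ_le_of_lt_width hε hδ hδ1 hn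
  -- Here `e` counts the selections of `b` made in exploration. The square root lags one selection
  -- behind, as the selection at count `N` is charged with the width at count `N`, and `1 / √N` is
  -- at most twice the increment from `√(N - 1)` to `√N`.
  have key : ∀ n ≤ T, ∃ e : ℕ, e ≤ count (history a r n ω) b ∧ (e : ℝ) ≤ Q ∧
      (∑ t ∈ Finset.range n, if a t ω = b then E.gap i b else 0) ≤ e * E.gapMax i
        + ε * ((A : ℝ) - 1) * count (history a r n ω) b
        + 4 * √2 * B * √((count (history a r n ω) b - 1 : ℕ) : ℝ) := by
    intro n
    induction n with
    | zero =>
      intro _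
      refine ⟨0, Nat.zero_le _, ?_, ?_⟩
      · have := hQ 0 (Or.inl rfl)
        push_cast at this ⊢
        linarith
      · rw [Finset.sum_range_zero]
        refine add_nonneg (add_nonneg (by simp) (mul_nonneg hA (Nat.cast_nonneg _)))
          (mul_nonneg hB (Real.sqrt_nonneg _))
    | succ n ih =>
      intro hn
      obtain ⟨e, he1, he2, he3⟩ := ih (by omega)
      rw [Finset.sum_range_succ, count_succ]
      by_cases hab : a n ω = b
      · simp only [hab, if_true]
        set N := count (history a r n ω) b with hN
        have hf' := hf n
        rw [hab] at hf'
        by_cases hex : (explore ε δ (history a r n ω)).Nonempty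
        · have h1 := hQ N (lt_width_of_mem_explore (hf'.1 hex))
          refine ⟨e + 1, by omega, ?_, ?_⟩
          · have : (e : ℝ) ≤ N := by exact_mod_cast he1
            push_cast
            linarith
          · have h2 := E.gap_le_gapMax i b
            rw [Nat.add_sub_cancel]
            have h3 : √((N - 1 : ℕ) : ℝ) ≤ √(N : ℝ) :=
              Real.sqrt_le_sqrt (by exact_mod_cast (by omega))
            have h4 := mul_le_mul_of_nonneg_left h3 hB
            push_cast
            linarith
        · obtain ⟨h1, h2⟩ := (hv n).gap_le hε.le hex (hf'.2 hex) hb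
          rw [← hN] at h1 h2
          have hle : N + 1 ≤ T := by
            have := count_le a r n ω b
            omega
          have h3 := width_le (A := A) (D := D) hδ hδ1 h1 hle
          have h4 := mul_le_mul_of_nonneg_left (one_div_sqrt_le h1)
            (by positivity : 0 ≤ √2 * B)
          refine ⟨e, by omega, he2, ?_⟩
          rw [Nat.add_sub_cancel]
          push_cast
          linarith
      · simp only [hab, if_false, add_zero]
        exact ⟨e, he1, he2, he3⟩
  obtain ⟨e, -, he2, he3⟩ := key T le_rfl
  have h1 := mul_le_mul_of_nonneg_right he2 (E.gapMax_nonneg i)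
  have h2 : √((count (history a r T ω) b - 1 : ℕ) : ℝ) ≤ √(count (history a r T ω) b : ℝ) :=
    Real.sqrt_le_sqrt (by exact_mod_cast (by omega))
  have h3 := mul_le_mul_of_nonneg_left h2 hB
  linarith

/-- The regret bound on the event that all confidence intervals are valid. -/
theorem regret_le [NeZero A] [NeZero D] {Ω : Type*} {a : ℕ → Ω → Fin A}
    {r : ℕ → Ω → Fin D → ℝ} {ω : Ω} {E : LexBandit A D} {ε δ : ℝ} (hε : 0 < ε) (hδ : 0 < δ)
    (hδ1 : δ < 1) (hv : ∀ t, Valid E δ (history a r t ω))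
    (hf : ∀ t, Follows ε δ (history a r t ω) (a t ω)) (i : Fin D) (T : ℕ) :
    E.regret i T (fun t => a t ω) ≤
      4 * √2 * √(1 + 2 * Real.log ((A : ℝ) * D * √(T : ℝ) / δ)) * √((E.subopt i).ncard * (T : ℝ))
        + (3 + 16 / ε ^ 2 * Real.log (2 * √(Real.exp 1) * A * D / (ε * δ))) *
          (E.subopt i).ncard * E.gapMax i
        + ε * ((A : ℝ) - 1) * T := by
  classical
  have hA : 0 ≤ ε * ((A : ℝ) - 1) := by
    have hA : (1 : ℝ) ≤ A := by exact_mod_cast NeZero.one_le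
    exact mul_nonneg hε.le (by linarith)
  set S : Finset (Fin A) := (E.subopt i).toFinset with hS
  have hcard : ((E.subopt i).ncard : ℝ) = S.card := by rw [Set.ncard_eq_toFinset_card']
  have hreg : E.regret i T (fun t => a t ω) =
      ∑ b ∈ S, ∑ t ∈ Finset.range T, if a t ω = b then E.gap i b else 0 := by
    rw [Finset.sum_comm, LexBandit.regret]
    refine Finset.sum_congr rfl fun t _ => ?_
    rw [Finset.sum_ite_eq]
    simp [hS]
  have hle := Finset.sum_le_sum fun b (hb : b ∈ S) =>
    arm_regret_le hε hδ hδ1 hv hf (Set.mem_toFinset.mp hb).1 T (i := i) (b := b)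
  rw [← hreg, Finset.sum_add_distrib, Finset.sum_add_distrib, Finset.sum_const, nsmul_eq_mul,
    ← Finset.mul_sum, ← Finset.mul_sum] at hle
  have hsum : ∑ b ∈ S, (count (history a r T ω) b : ℝ) ≤ T := by
    have h1 : ∑ b ∈ S, count (history a r T ω) b ≤ T :=
      (Finset.sum_le_sum_of_subset (Finset.subset_univ S)).trans (sum_count a r T ω).le
    exact_mod_cast h1
  -- Cauchy–Schwarz over the suboptimal arms, whose counts add up to at most `T`.
  have hsqrt : ∑ b ∈ S, √(count (history a r T ω) b : ℝ) ≤ √((E.subopt i).ncard * (T : ℝ)) := by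
    refine Real.le_sqrt_of_sq_le ?_
    refine sq_sum_le_card_mul_sum_sq.trans ?_
    rw [hcard]
    refine mul_le_mul_of_nonneg_left ?_ (by positivity)
    refine le_trans (le_of_eq (Finset.sum_congr rfl fun b _ => ?_)) hsum
    exact Real.sq_sqrt (by positivity)
  have h1 := mul_le_mul_of_nonneg_left hsum hA
  have h2 := mul_le_mul_of_nonneg_left hsqrt
    (by positivity : 0 ≤ 4 * √2 * √(1 + 2 * Real.log ((A : ℝ) * D * √(T : ℝ) / δ)))
  rw [← hcard] at hle
  linarith

end PFLEX

/-! ### Maximal inequality and Gaussian mixture supermartingale -/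

/-- The maximal inequality for nonnegative supermartingales, in a form that uses the supermartingale
property only on the events that the level `c` has not been reached yet. -/
theorem measure_exists_ge_le {Ω : Type*} [MeasurableSpace Ω] {P : Measure Ω} {M : ℕ → Ω → ℝ≥0∞}
    (hM : ∀ t, Measurable (M t)) {c : ℝ≥0∞}
    (hstep : ∀ t, ∫⁻ ω in {ω | ∀ s ≤ t, M s ω < c}, M (t + 1) ω ∂P ≤
      ∫⁻ ω in {ω | ∀ s ≤ t, M s ω < c}, M t ω ∂P) :
    c * P {ω | ∃ t, c ≤ M t ω} ≤ ∫⁻ ω, M 0 ω ∂P := by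
  -- Stop the process on reaching `c`: the stopped paths contribute at least `c` each, the others
  -- their current value, and this total stays below the initial integral.
  have key : ∀ t, c * P {ω | ∃ s ≤ t, c ≤ M s ω} + ∫⁻ ω in {ω | ∀ s ≤ t, M s ω < c}, M t ω ∂P ≤
      ∫⁻ ω, M 0 ω ∂P := by
    intro t
    induction t with
    | zero =>
      have h1 : {ω | ∃ s ≤ 0, c ≤ M s ω} = {ω | c ≤ M 0 ω} := by ext; simp
      have h2 : {ω | ∀ s ≤ 0, M s ω < c} = {ω | c ≤ M 0 ω}ᶜ := by ext; simp
      have hm : MeasurableSet {ω | c ≤ M 0 ω} := measurableSet_le measurable_const (hM 0)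
      rw [h1, h2, ← lintegral_add_compl (μ := P) (M 0) hm, ← setLIntegral_const]
      gcongr ?_ + _
      exact setLIntegral_mono (hM 0) fun ω hω => hω
    | succ t ih =>
      set U := {ω | ∀ s ≤ t, M s ω < c} with hU
      set V := {ω | c ≤ M (t + 1) ω} with hV
      have hVm : MeasurableSet V := measurableSet_le measurable_const (hM _)
      have h1 : {ω | ∃ s ≤ t + 1, c ≤ M s ω} = {ω | ∃ s ≤ t, c ≤ M s ω} ∪ (U ∩ V) := by
        ext ω
        simp only [Set.mem_ofPred_eq, Set.mem_union, Set.mem_inter_iff, hU, hV]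
        constructor
        · rintro ⟨s, hs, h⟩
          by_cases hex : ∃ s ≤ t, c ≤ M s ω
          · exact Or.inl hex
          · push Not at hex
            rcases Nat.lt_or_ge t s with h' | h'
            · obtain rfl : s = t + 1 := by omega
              exact Or.inr ⟨hex, h⟩
            · exact absurd h (not_le.mpr (hex s h'))
        · rintro (⟨s, hs, h⟩ | ⟨_, h⟩)
          · exact ⟨s, by omega, h⟩
          · exact ⟨t + 1, le_rfl, h⟩
      have h2 : {ω | ∀ s ≤ t + 1, M s ω < c} = U ∩ Vᶜ := by
        ext ω
        simp only [Set.mem_ofPred_eq, Set.mem_inter_iff, hU, hV, Set.mem_compl_iff, not_le]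
        constructor
        · exact fun h => ⟨fun s hs => h s (by omega), h _ le_rfl⟩
        · rintro ⟨h3, h4⟩ s hs
          rcases Nat.lt_or_ge t s with h' | h'
          · obtain rfl : s = t + 1 := by omega
            exact h4
          · exact h3 s h'
      rw [h1, h2]
      calc _ ≤ c * (P {ω | ∃ s ≤ t, c ≤ M s ω} + P (U ∩ V)) + ∫⁻ ω in U ∩ Vᶜ, M (t + 1) ω ∂P := by
            gcongr
            exact measure_union_le _ _
        _ = c * P {ω | ∃ s ≤ t, c ≤ M s ω} +
              (∫⁻ _ in U ∩ V, c ∂P + ∫⁻ ω in U ∩ Vᶜ, M (t + 1) ω ∂P) := by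
            rw [setLIntegral_const, mul_add, add_assoc]
        _ ≤ c * P {ω | ∃ s ≤ t, c ≤ M s ω} +
              (∫⁻ ω in U ∩ V, M (t + 1) ω ∂P + ∫⁻ ω in U ∩ Vᶜ, M (t + 1) ω ∂P) := by
            gcongr _ + (?_ + _)
            exact setLIntegral_mono (hM _) fun ω hω => hω.2
        _ = c * P {ω | ∃ s ≤ t, c ≤ M s ω} + ∫⁻ ω in U, M (t + 1) ω ∂P := by
            rw [← Set.sdiff_eq, lintegral_inter_add_sdiff _ _ hVm]
        _ ≤ c * P {ω | ∃ s ≤ t, c ≤ M s ω} + ∫⁻ ω in U, M t ω ∂P := by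
            gcongr _ + ?_
            exact hstep t
        _ ≤ _ := ih
  have hunion : {ω | ∃ t, c ≤ M t ω} = ⋃ t, {ω | ∃ s ≤ t, c ≤ M s ω} := by
    ext ω
    simp only [Set.mem_ofPred_eq, Set.mem_iUnion]
    exact ⟨fun ⟨t, h⟩ => ⟨t, t, le_rfl, h⟩, fun ⟨_, s, _, h⟩ => ⟨s, h⟩⟩
  have hmono : Monotone fun t => {ω | ∃ s ≤ t, c ≤ M s ω} :=
    fun t u htu ω ⟨s, hs, h⟩ => ⟨s, hs.trans htu, h⟩
  rw [hunion, hmono.measure_iUnion, ENNReal.mul_iSup]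
  exact iSup_le fun t => le_self_add.trans (key t)

/-- The exponential supermartingale of a sum `s` of `n` sub-Gaussian variables, mixed over its
parameter with a standard Gaussian law. -/
noncomputable def gaussianMixture (n s : ℝ) : ℝ≥0∞ :=
  ∫⁻ l, ENNReal.ofReal (Real.exp (l * s - l ^ 2 * n / 2)) ∂(gaussianReal 0 1)

theorem measurable_gaussianMixture : Measurable fun p : ℝ × ℝ => gaussianMixture p.1 p.2 := by
  unfold gaussianMixture
  exact Measurable.lintegral_prod_right'
    (f := fun q : (ℝ × ℝ) × ℝ => ENNReal.ofReal (Real.exp (q.2 * q.1.2 - q.2 ^ 2 * q.1.1 / 2)))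
    (by fun_prop)

/-- Completing the square turns the integrand into a constant times the Gaussian density with mean
`s / (1 + n)` and variance `1 / (1 + n)`, which integrates to one. -/
theorem gaussianMixture_eq {n : ℝ} (hn : 0 ≤ n) (s : ℝ) :
    gaussianMixture n s = ENNReal.ofReal ((√(1 + n))⁻¹ * Real.exp (s ^ 2 / (2 * (1 + n)))) := by
  have hinv : 0 < (1 + n)⁻¹ := by positivity
  have hv : (1 + n)⁻¹.toNNReal ≠ 0 := (Real.toNNReal_pos.mpr hinv).ne'
  rw [gaussianMixture, gaussianReal_of_var_ne_zero _ one_ne_zero,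
    lintegral_withDensity_eq_lintegral_mul _ (measurable_gaussianPDF _ _) (by fun_prop)]
  have hpt : ∀ l : ℝ, (gaussianPDF 0 1 * fun l => ENNReal.ofReal (Real.exp (l * s - l ^ 2 * n / 2))) l
      = ENNReal.ofReal ((√(1 + n))⁻¹ * Real.exp (s ^ 2 / (2 * (1 + n)))) *
        gaussianPDF (s / (1 + n)) (1 + n)⁻¹.toNNReal l := by
    intro l
    rw [Pi.mul_apply, gaussianPDF, gaussianPDF, ← ENNReal.ofReal_mul (gaussianPDFReal_nonneg _ _ _),
      ← ENNReal.ofReal_mul (by positivity)]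
    congr 1
    simp only [gaussianPDFReal, Real.coe_toNNReal _ hinv.le, NNReal.coe_one]
    have e1 : √(2 * Real.pi * (1 + n)⁻¹) = √(2 * Real.pi) * (√(1 + n))⁻¹ := by
      rw [Real.sqrt_mul (by positivity), Real.sqrt_inv]
    have e2 : √(1 + n) ≠ 0 := by positivity
    have e3 : √(2 * Real.pi) ≠ 0 := by positivity
    rw [e1, mul_one, mul_assoc, ← Real.exp_add, mul_mul_mul_comm, ← Real.exp_add]
    have e4 : (√(1 + n))⁻¹ * (√(2 * Real.pi) * (√(1 + n))⁻¹)⁻¹ = (√(2 * Real.pi))⁻¹ := by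
      field_simp
    rw [e4]
    congr 2
    have e5 : 1 + n ≠ 0 := by positivity
    field_simp
    ring
  simp_rw [hpt]
  rw [lintegral_const_mul _ (measurable_gaussianPDF _ _), lintegral_gaussianPDF_eq_one _ hv, mul_one]

namespace LexBandit

variable {A D : ℕ}

theorem lintegral_exp_noise_le (E : LexBandit A D) (b : Fin A) (i : Fin D) (l : ℝ) :
    ∫⁻ x, ENNReal.ofReal (Real.exp (l * x i)) ∂(E.noise b) ≤ ENNReal.ofReal (Real.exp (l ^ 2 / 2)) := by
  have h := E.noise_subgaussian b i
  rw [← ofReal_integral_eq_lintegral_ofReal (h.integrable_exp_mul l)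
    (ae_of_all _ fun _ => (Real.exp_pos _).le)]
  refine ENNReal.ofReal_le_ofReal ?_
  simpa [mgf] using h.mgf_le l

/-- The supermartingale step for one reward. For each fixed `l` the sub-Gaussian factor `exp (l² /
2)` is cancelled by the increase of `n` by one, and Tonelli passes this to the mixture. -/
theorem lintegral_gaussianMixture_le (E : LexBandit A D) (b : Fin A) (i : Fin D) (n s : ℝ) :
    ∫⁻ x, gaussianMixture (n + 1) (s + (x i - E.mean b i)) ∂(E.rewardKernel b) ≤
      gaussianMixture n s := by
  have := E.isProbabilityMeasure_noise b
  have hm : Measurable fun x : Fin D → ℝ => gaussianMixture (n + 1) (s + (x i - E.mean b i)) :=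
    measurable_gaussianMixture.comp (f := fun x : Fin D → ℝ => (n + 1, s + (x i - E.mean b i)))
      (by fun_prop)
  change ∫⁻ x, _ ∂((E.noise b).map fun x => E.mean b + x) ≤ _
  rw [lintegral_map hm (by fun_prop)]
  simp only [Pi.add_apply, add_sub_cancel_left]
  unfold gaussianMixture
  rw [lintegral_lintegral_swap (by fun_prop)]
  refine lintegral_mono fun l => ?_
  have e1 : ∀ x : Fin D → ℝ, ENNReal.ofReal (Real.exp (l * (s + x i) - l ^ 2 * (n + 1) / 2)) =
      ENNReal.ofReal (Real.exp (l * s - l ^ 2 * n / 2 - l ^ 2 / 2)) *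
        ENNReal.ofReal (Real.exp (l * x i)) := by
    intro x
    rw [← ENNReal.ofReal_mul (Real.exp_pos _).le, ← Real.exp_add]
    congr 2
    ring
  simp_rw [e1]
  rw [lintegral_const_mul _ (by fun_prop)]
  refine (mul_le_mul_right (E.lintegral_exp_noise_le b i l) _).trans (le_of_eq ?_)
  rw [← ENNReal.ofReal_mul (Real.exp_pos _).le, ← Real.exp_add]
  congr 2
  ring

end LexBandit

/-! ### Validity of the confidence intervals along an interaction -/

namespace PFLEX

variable {A D : ℕ}

/-- The sum of the observed noise of arm `b` in objective `i`. -/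
noncomputable def noiseSum {t : ℕ} (E : LexBandit A D) (b : Fin A) (i : Fin D) (h : History A D t) :
    ℝ :=
  ∑ s, if (h s).1 = b then (h s).2 i - E.mean b i else 0

theorem noiseSum_succ {Ω : Type*} (E : LexBandit A D) (b : Fin A) (i : Fin D) (a : ℕ → Ω → Fin A)
    (r : ℕ → Ω → Fin D → ℝ) (t : ℕ) (ω : Ω) :
    noiseSum E b i (history a r (t + 1) ω) = noiseSum E b i (history a r t ω) +
      if a t ω = b then r t ω i - E.mean b i else 0 := by
  unfold noiseSum
  rw [Fin.sum_univ_castSucc]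
  rfl

theorem sampleMean_sub_mean {t : ℕ} (E : LexBandit A D) (b : Fin A) (i : Fin D) (h : History A D t)
    (hb : count h b ≠ 0) :
    sampleMean h b i - E.mean b i = noiseSum E b i h / count h b := by
  have hb' : (count h b : ℝ) ≠ 0 := Nat.cast_ne_zero.mpr hb
  rw [sampleMean, div_sub' hb']
  congr 1
  have h1 : (count h b : ℝ) * E.mean b i = ∑ s, if (h s).1 = b then E.mean b i else 0 := by
    rw [count, Finset.card_filter, Nat.cast_sum, Finset.sum_mul]
    exact Finset.sum_congr rfl fun s _ => by split_ifs <;> simp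
  rw [h1, noiseSum, ← Finset.sum_sub_distrib]
  exact Finset.sum_congr rfl fun s _ => by split_ifs <;> simp

theorem measurable_count {t : ℕ} (b : Fin A) :
    Measurable fun h : History A D t => (count h b : ℝ) := by
  unfold count
  simp only [Finset.card_filter, Nat.cast_sum]
  refine Finset.measurable_sum _ fun s _ => ?_
  have hs : MeasurableSet {h : History A D t | (h s).1 = b} :=
    (measurable_pi_apply s).fst (measurableSet_singleton b)
  simp only [Nat.cast_ite, Nat.cast_one, Nat.cast_zero]
  exact Measurable.ite hs measurable_const measurable_const

theorem measurable_noiseSum {t : ℕ} (E : LexBandit A D) (b : Fin A) (i : Fin D) :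
    Measurable fun h : History A D t => noiseSum E b i h := by
  unfold noiseSum
  refine Finset.measurable_sum _ fun s _ => ?_
  have hs : MeasurableSet {h : History A D t | (h s).1 = b} :=
    (measurable_pi_apply s).fst (measurableSet_singleton b)
  exact Measurable.ite hs (by fun_prop) measurable_const

/-- The supermartingale that controls the sample mean of arm `b` in objective `i`. -/
noncomputable def mixtureProcess {t : ℕ} (E : LexBandit A D) (b : Fin A) (i : Fin D)
    (h : History A D t) : ℝ≥0∞ :=
  gaussianMixture (count h b) (noiseSum E b i h)

theorem measurable_mixtureProcess {t : ℕ} (E : LexBandit A D) (b : Fin A) (i : Fin D) :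
    Measurable fun h : History A D t => mixtureProcess E b i h :=
  measurable_gaussianMixture.comp ((measurable_count b).prodMk (measurable_noiseSum E b i))

theorem measurable_history {Ω : Type*} [MeasurableSpace Ω] {a : ℕ → Ω → Fin A}
    {r : ℕ → Ω → Fin D → ℝ} (ha : ∀ t, Measurable (a t)) (hr : ∀ t, Measurable (r t)) (t : ℕ) :
    Measurable (history a r t) :=
  measurable_pi_lambda _ fun s => (ha s).prodMk (hr s)

/-- Conditionally on the history and the selected arm, the process is unchanged if the arm is not
`b`, and otherwise the one-reward bound applies. Only the reward law enters, so the bound holds for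
every policy. -/
theorem setLIntegral_mixtureProcess_succ_le {E : LexBandit A D}
    {π : (t : ℕ) → Kernel (History A D t) (Fin A)} {Ω : Type*} [MeasurableSpace Ω] {P : Measure Ω}
    [IsProbabilityMeasure P] {a : ℕ → Ω → Fin A} {r : ℕ → Ω → Fin D → ℝ}
    (hI : E.IsInteraction π P a r) (b : Fin A) (i : Fin D) {t : ℕ} {S : Set (History A D t)}
    (hS : MeasurableSet S) :
    ∫⁻ ω in history a r t ⁻¹' S, mixtureProcess E b i (history a r (t + 1) ω) ∂P ≤
      ∫⁻ ω in history a r t ⁻¹' S, mixtureProcess E b i (history a r t ω) ∂P := by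
  have hH := measurable_history hI.measurable_arm hI.measurable_reward t
  have hHS := hH hS
  have hHa : Measurable fun ω => (history a r t ω, a t ω) := hH.prodMk (hI.measurable_arm t)
  let G : (History A D t × Fin A) × (Fin D → ℝ) → ℝ≥0∞ := fun p =>
    gaussianMixture (count p.1.1 b + if p.1.2 = b then 1 else 0)
      (noiseSum E b i p.1.1 + if p.1.2 = b then p.2 i - E.mean b i else 0)
  let F : (History A D t × Fin A) × (Fin D → ℝ) → ℝ≥0∞ :=
    {p | p.1.1 ∈ S}.indicator G
  have hG : Measurable G := by
    have hb : MeasurableSet {p : (History A D t × Fin A) × (Fin D → ℝ) | p.1.2 = b} :=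
      measurable_fst.snd (measurableSet_singleton b)
    have h1 : Measurable fun p : (History A D t × Fin A) × (Fin D → ℝ) => (count p.1.1 b : ℝ) :=
      (measurable_count b).comp measurable_fst.fst
    have h2 : Measurable fun p : (History A D t × Fin A) × (Fin D → ℝ) => noiseSum E b i p.1.1 :=
      (measurable_noiseSum E b i).comp measurable_fst.fst
    exact measurable_gaussianMixture.comp
      ((h1.add (Measurable.ite hb measurable_const measurable_const)).prodMk
        (h2.add (Measurable.ite hb (by fun_prop) measurable_const)))
  have hF : Measurable F := hG.indicator (measurable_fst.fst hS)
  let g : History A D t × Fin A → ℝ≥0∞ :=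
    {p | p.1 ∈ S}.indicator fun p => mixtureProcess E b i p.1
  have hg : Measurable g :=
    ((measurable_mixtureProcess E b i).comp measurable_fst).indicator (measurable_fst hS)
  have hinner : ∀ p, ∫⁻ x, F (p, x) ∂(Kernel.prodMkLeft (History A D t) E.rewardKernel p) ≤ g p := by
    rintro ⟨h, c⟩
    rw [Kernel.prodMkLeft_apply]
    by_cases hh : h ∈ S
    · have e1 : ∀ x, F ((h, c), x) = G ((h, c), x) :=
        fun x => Set.indicator_of_mem (s := {p | p.1.1 ∈ S}) hh G
      have e2 : g (h, c) = mixtureProcess E b i h :=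
        Set.indicator_of_mem (s := {p : History A D t × Fin A | p.1 ∈ S}) hh _
      simp_rw [e1, e2]
      by_cases hc : c = b
      · subst hc
        simp only [G, if_true]
        exact E.lintegral_gaussianMixture_le c i _ _
      · simp only [G, hc, if_false, add_zero]
        rw [lintegral_const, measure_univ, mul_one]
        exact le_rfl
    · have e1 : ∀ x, F ((h, c), x) = 0 :=
        fun x => Set.indicator_of_notMem (s := {p | p.1.1 ∈ S}) hh G
      simp [e1]
  have hlaw := hI.reward_law t
  calc _ = ∫⁻ ω, F ((history a r t ω, a t ω), r t ω) ∂P := by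
        rw [← lintegral_indicator hHS]
        refine lintegral_congr fun ω => ?_
        by_cases hh : history a r t ω ∈ S
        · rw [Set.indicator_of_mem (by exact hh)]
          change _ = Set.indicator {p | p.1.1 ∈ S} G _
          rw [Set.indicator_of_mem (by exact hh), mixtureProcess, count_succ, noiseSum_succ]
          simp [G]
        · rw [Set.indicator_of_notMem (by exact hh)]
          exact (Set.indicator_of_notMem
            (s := {p : (History A D t × Fin A) × (Fin D → ℝ) | p.1.1 ∈ S})
            (a := ((history a r t ω, a t ω), r t ω)) hh G).symm
    _ = ∫⁻ q, F q ∂(P.map fun ω => ((history a r t ω, a t ω), r t ω)) :=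
        (lintegral_map hF (hHa.prodMk (hI.measurable_reward t))).symm
    _ = ∫⁻ p, ∫⁻ x, F (p, x) ∂(Kernel.prodMkLeft (History A D t) E.rewardKernel p)
          ∂(P.map fun ω => (history a r t ω, a t ω)) := by
        rw [hlaw.map_eq, Measure.lintegral_compProd hF]
    _ ≤ ∫⁻ p, g p ∂(P.map fun ω => (history a r t ω, a t ω)) := lintegral_mono hinner
    _ = ∫⁻ ω, g (history a r t ω, a t ω) ∂P := lintegral_map hg hHa
    _ = _ := by
        rw [← lintegral_indicator hHS]
        rfl

theorem measure_le_mixtureProcess {E : LexBandit A D}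
    {π : (t : ℕ) → Kernel (History A D t) (Fin A)} {Ω : Type*} [MeasurableSpace Ω] {P : Measure Ω}
    [IsProbabilityMeasure P] {a : ℕ → Ω → Fin A} {r : ℕ → Ω → Fin D → ℝ}
    (hI : E.IsInteraction π P a r) (b : Fin A) (i : Fin D) (c : ℝ≥0∞) :
    c * P {ω | ∃ t, c ≤ mixtureProcess E b i (history a r t ω)} ≤ 1 := by
  have hM : ∀ t, Measurable fun ω => mixtureProcess E b i (history a r t ω) := fun t =>
    (measurable_mixtureProcess E b i).comp
      (measurable_history hI.measurable_arm hI.measurable_reward t)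
  refine (measure_exists_ge_le hM (fun t => ?_)).trans ?_
  -- The event that the level has not been reached, written as a condition on the history of `t`
  -- rounds through all its prefixes.
  · let S : Set (History A D t) :=
      ⋂ s : Fin (t + 1), {h | mixtureProcess E b i (fun u : Fin s => h (Fin.castLE (by omega) u)) < c}
    have hS : MeasurableSet S := MeasurableSet.iInter fun s => measurableSet_lt
      ((measurable_mixtureProcess E b i).comp
        (measurable_pi_lambda _ fun u => measurable_pi_apply _)) measurable_const
    have hset : {ω | ∀ s ≤ t, mixtureProcess E b i (history a r s ω) < c} = history a r t ⁻¹' S := by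
      ext ω
      simp only [S, Set.mem_preimage, Set.mem_iInter]
      exact ⟨fun h s => h s (by omega), fun h s hs => h ⟨s, by omega⟩⟩
    rw [hset]
    exact setLIntegral_mixtureProcess_succ_le hI b i hS
  · have h0 : ∀ ω, mixtureProcess E b i (history a r 0 ω) = 1 := by
      intro ω
      simp [mixtureProcess, count, noiseSum, gaussianMixture]
    simp [h0]

/-- Taking logarithms in the closed form of the mixture and solving for the noise sum gives
precisely `width`. -/
theorem valid_of_mixtureProcess_lt [NeZero A] [NeZero D] {E : LexBandit A D} {δ : ℝ} (hδ : 0 < δ)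
    (hδ1 : δ < 1) {t : ℕ} {h : History A D t}
    (hM : ∀ b i, mixtureProcess E b i h < ENNReal.ofReal ((A : ℝ) * D / δ)) : Valid E δ h := by
  intro b i hb
  have hK := one_le_confidence_ratio (A := A) (D := D) hδ hδ1
  have hlt := hM b i
  set n : ℝ := (count h b : ℝ) with hn
  set s := noiseSum E b i h with hs
  have hn0 : 0 < n := Nat.cast_pos.mpr (Nat.pos_of_ne_zero hb)
  rw [mixtureProcess, gaussianMixture_eq hn0.le, ENNReal.ofReal_lt_ofReal_iff (by linarith)] at hlt
  have h1 := Real.log_lt_log (by positivity) hlt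
  rw [Real.log_mul (by positivity) (by positivity), Real.log_exp, Real.log_inv,
    Real.log_sqrt (by positivity)] at h1
  have h2 : s ^ 2 ≤ (1 + n) * (1 + 2 * (Real.log ((A : ℝ) * D / δ) + Real.log (1 + n) / 2)) := by
    have h3 : s ^ 2 / (2 * (1 + n)) ≤ Real.log ((A : ℝ) * D / δ) + Real.log (1 + n) / 2 := by
      linarith
    rw [div_le_iff₀ (by positivity)] at h3
    nlinarith
  rw [sampleMean_sub_mean E b i h hb, width, ← hn, ← hs]
  refine Real.abs_le_sqrt ?_
  rw [log_confidence hδ hδ1 (by positivity), div_pow, div_mul_eq_mul_div]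
  gcongr

/-- With high probability all confidence intervals are always valid. -/
theorem measure_not_valid_le [NeZero A] [NeZero D] {E : LexBandit A D}
    {π : (t : ℕ) → Kernel (History A D t) (Fin A)} {Ω : Type*} [MeasurableSpace Ω] {P : Measure Ω}
    [IsProbabilityMeasure P] {a : ℕ → Ω → Fin A} {r : ℕ → Ω → Fin D → ℝ}
    (hI : E.IsInteraction π P a r) {δ : ℝ} (hδ : 0 < δ) (hδ1 : δ < 1) :
    P {ω | ¬ ∀ t, Valid E δ (history a r t ω)} ≤ ENNReal.ofReal δ := by
  have hK := one_le_confidence_ratio (A := A) (D := D) hδ hδ1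
  have hA : (0 : ℝ) < A := Nat.cast_pos.mpr (NeZero.pos A)
  have hD : (0 : ℝ) < D := Nat.cast_pos.mpr (NeZero.pos D)
  set c := ENNReal.ofReal ((A : ℝ) * D / δ) with hc
  have hsub : {ω | ¬ ∀ t, Valid E δ (history a r t ω)} ⊆
      ⋃ p : Fin A × Fin D, {ω | ∃ t, c ≤ mixtureProcess E p.1 p.2 (history a r t ω)} := by
    intro ω hω
    by_contra hnot
    refine hω fun t => valid_of_mixtureProcess_lt hδ hδ1 fun b i => ?_
    by_contra hle
    exact hnot (Set.mem_iUnion.mpr ⟨(b, i), t, not_lt.mp hle⟩)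
  have hone : ∀ p : Fin A × Fin D,
      P {ω | ∃ t, c ≤ mixtureProcess E p.1 p.2 (history a r t ω)} ≤ ENNReal.ofReal (δ / (A * D)) := by
    intro p
    have h1 := measure_le_mixtureProcess hI p.1 p.2 c
    have hinv : ENNReal.ofReal (δ / (A * D)) = c⁻¹ := by
      rw [hc, ← ENNReal.ofReal_inv_of_pos (by linarith), inv_div]
    rw [hinv, ENNReal.le_inv_iff_mul_le, mul_comm]
    exact h1
  calc _ ≤ _ := measure_mono hsub
    _ ≤ ∑ p : Fin A × Fin D, P {ω | ∃ t, c ≤ mixtureProcess E p.1 p.2 (history a r t ω)} :=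
        measure_iUnion_fintype_le _ _
    _ ≤ ∑ _p : Fin A × Fin D, ENNReal.ofReal (δ / (A * D)) := Finset.sum_le_sum fun p _ => hone p
    _ = ENNReal.ofReal δ := by
        rw [Finset.sum_const, Finset.card_univ, Fintype.card_prod, Fintype.card_fin, Fintype.card_fin,
          nsmul_eq_mul, ← ENNReal.ofReal_natCast, ← ENNReal.ofReal_mul (by positivity)]
        congr 1
        push_cast
        field_simp

/-- Almost surely the selected arm has positive probability under the policy, since there are
finitely many arms. Of the uniform draw only the support matters. -/
theorem ae_follows [NeZero D] {E : LexBandit A D} {ε δ : ℝ}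
    {π : (t : ℕ) → Kernel (History A D t) (Fin A)} (hπ : IsPolicy ε δ π) {Ω : Type*}
    [MeasurableSpace Ω] {P : Measure Ω} [IsProbabilityMeasure P] {a : ℕ → Ω → Fin A}
    {r : ℕ → Ω → Fin D → ℝ} (hI : E.IsInteraction π P a r) :
    ∀ᵐ ω ∂P, ∀ t, Follows ε δ (history a r t ω) (a t ω) := by
  rw [ae_all_iff]
  intro t
  have := hπ.isMarkovKernel t
  have hH := measurable_history hI.measurable_arm hI.measurable_reward t
  have hnull : ∀ b, ∀ᵐ ω ∂P, ¬ (π t (history a r t ω) {b} = 0 ∧ a t ω = b) := by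
    intro b
    have hZ : MeasurableSet {h | π t h {b} = 0} :=
      (π t).measurable_coe (measurableSet_singleton b) (measurableSet_singleton 0)
    -- The joint law of history and arm gives no mass to histories on which `b` has probability zero
    -- together with the choice of `b`.
    have h1 : P.map (fun ω => (history a r t ω, a t ω)) ({h | π t h {b} = 0} ×ˢ {b}) = 0 := by
      rw [(hI.arm_law t).map_eq, Measure.compProd_apply_prod hZ (measurableSet_singleton b)]
      exact setLIntegral_eq_zero hZ fun h hh => hh
    rw [Measure.map_apply (hH.prodMk (hI.measurable_arm t))
      (hZ.prod (measurableSet_singleton b))] at h1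
    rw [ae_iff]
    simp only [not_not]
    exact h1
  filter_upwards [ae_all_iff.mpr hnull] with ω hω
  have hne : π t (history a r t ω) {a t ω} ≠ 0 := fun h => hω (a t ω) ⟨h, rfl⟩
  constructor
  · intro hex
    by_contra hnot
    rw [hπ.uniform t _ hex] at hne
    exact hne ((uniformOn_eq_zero_iff (Set.toFinite _)).mpr
      (Set.inter_singleton_eq_empty.mpr hnot))
  · intro hex
    by_contra hnot
    have h1 := hπ.optimistic t _ hex
    have h2 : π t (history a r t ω) (exploit δ (history a r t ω))ᶜ = 0 :=
      (prob_compl_eq_zero_iff (Set.toFinite _).measurableSet).mpr h1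
    exact hne (measure_mono_null (Set.singleton_subset_iff.mpr hnot) h2)

/-- With high probability all confidence intervals are always valid and PF-LEX is followed. -/
theorem measure_not_valid_or_not_follows_le [NeZero A] [NeZero D] {E : LexBandit A D} {ε δ : ℝ}
    {π : (t : ℕ) → Kernel (History A D t) (Fin A)} (hπ : IsPolicy ε δ π) {Ω : Type*}
    [MeasurableSpace Ω] {P : Measure Ω} [IsProbabilityMeasure P] {a : ℕ → Ω → Fin A}
    {r : ℕ → Ω → Fin D → ℝ} (hI : E.IsInteraction π P a r) (hδ : 0 < δ) (hδ1 : δ < 1) :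
    P {ω | ¬ ∀ t, Valid E δ (history a r t ω) ∧ Follows ε δ (history a r t ω) (a t ω)} ≤
      ENNReal.ofReal δ := by
  have h1 := measure_not_valid_le hI hδ hδ1
  have h2 := ae_iff.mp (ae_follows hπ hI)
  refine le_trans (measure_mono fun ω hω => ?_) ((measure_union_le
    {ω | ¬ ∀ t, Valid E δ (history a r t ω)}
    {ω | ¬ ∀ t, Follows ε δ (history a r t ω) (a t ω)}).trans ?_)
  · by_contra hnot
    refine hω fun t => ⟨?_, ?_⟩
    · by_contra h
      exact hnot (Or.inl fun h' => h (h' t))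
    · by_contra h
      exact hnot (Or.inr fun h' => h (h' t))
  · rw [h2, add_zero]
    exact h1

end PFLEX

/-! ### From high probability to expectation -/

theorem one_sub_le_measureReal {Ω : Type*} [MeasurableSpace Ω] {P : Measure Ω}
    [IsProbabilityMeasure P] {S : Set Ω} {δ : ℝ} (hδ : 0 ≤ δ) (hS : P Sᶜ ≤ ENNReal.ofReal δ) :
    1 - δ ≤ P.real S := by
  have h1 : P.real Sᶜ ≤ δ := ENNReal.toReal_le_of_le_ofReal hδ hS
  have h2 : P.real (S ∪ Sᶜ) ≤ P.real S + P.real Sᶜ := measureReal_union_le S Sᶜ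
  rw [Set.union_compl_self, probReal_univ] at h2
  linarith

namespace LexBandit

variable {A D : ℕ} [NeZero A]

theorem regret_le_mul_gapMax (E : LexBandit A D) (i : Fin D) (T : ℕ) (a : ℕ → Fin A) :
    E.regret i T a ≤ T * E.gapMax i := by
  classical
  have h := Finset.sum_le_card_nsmul (Finset.range T)
    (fun t => if a t ∈ E.subopt i then E.gap i (a t) else 0) (E.gapMax i) (fun t _ => by
      split_ifs
      · exact E.gap_le_gapMax i _
      · exact E.gapMax_nonneg i)
  rw [Finset.card_range, nsmul_eq_mul] at h
  refine le_trans (le_of_eq ?_) h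
  rw [regret]

theorem integrable_regret (E : LexBandit A D) (i : Fin D) (T : ℕ) {Ω : Type*} [MeasurableSpace Ω]
    {P : Measure Ω} [IsFiniteMeasure P] {a : ℕ → Ω → Fin A} (ha : ∀ t, Measurable (a t)) :
    Integrable (fun ω => E.regret i T (fun t => a t ω)) P := by
  classical
  unfold regret
  refine integrable_finsetSum _ fun t _ => ?_
  let f : Fin A → ℝ := fun b => if b ∈ E.subopt i then E.gap i b else 0
  have hf : Integrable (fun ω => f (a t ω)) P := by
    refine Integrable.of_bound ((measurable_of_finite f).comp (ha t)).aestronglyMeasurable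
      (∑ b, ‖f b‖) (ae_of_all _ fun ω => ?_)
    exact Finset.single_le_sum (f := fun b => ‖f b‖) (fun b _ => norm_nonneg _)
      (Finset.mem_univ (a t ω))
  convert hf using 3

end LexBandit

namespace PFLEX

variable {A D : ℕ}

/-- The regret bound for a given horizon on the event that all confidence intervals are valid. -/
theorem regret_le_of_horizon [NeZero A] [NeZero D] {Ω : Type*} {a : ℕ → Ω → Fin A}
    {r : ℕ → Ω → Fin D → ℝ} {ω : Ω} {E : LexBandit A D} {δ : ℝ} {T : ℕ} (hT : 1 ≤ T) (hδ : 0 < δ)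
    (hδ1 : δ < 1)
    (hg : ∀ t, Valid E δ (history a r t ω) ∧
      Follows ((T : ℝ) ^ (-(1 / 3) : ℝ)) δ (history a r t ω) (a t ω)) (i : Fin D) :
    E.regret i T (fun t => a t ω) ≤
      4 * √2 * √(1 + 2 * Real.log ((A : ℝ) * D * √(T : ℝ) / δ)) * √((E.subopt i).ncard * (T : ℝ))
        + (3 + 16 * (T : ℝ) ^ (2 / 3 : ℝ) *
            Real.log (2 * √(Real.exp 1) * A * D * (T : ℝ) ^ (1 / 3 : ℝ) / δ)) *
          (E.subopt i).ncard * E.gapMax i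
        + ((A : ℝ) - 1) * (T : ℝ) ^ (2 / 3 : ℝ) := by
  have hT0 : (0 : ℝ) < T := Nat.cast_pos.mpr hT
  have h := regret_le (Real.rpow_pos_of_pos hT0 _) hδ hδ1 (fun t => (hg t).1)
    (fun t => (hg t).2) i T
  have e1 : 16 / ((T : ℝ) ^ (-(1 / 3) : ℝ)) ^ 2 = 16 * (T : ℝ) ^ (2 / 3 : ℝ) := by
    rw [← Real.rpow_natCast, ← Real.rpow_mul hT0.le, div_eq_mul_inv, ← Real.rpow_neg hT0.le]
    norm_num
  have e2 : 2 * √(Real.exp 1) * A * D / ((T : ℝ) ^ (-(1 / 3) : ℝ) * δ) =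
      2 * √(Real.exp 1) * A * D * (T : ℝ) ^ (1 / 3 : ℝ) / δ := by
    rw [Real.rpow_neg hT0.le]
    field_simp
  have e3 : (T : ℝ) ^ (-(1 / 3) : ℝ) * ((A : ℝ) - 1) * T = ((A : ℝ) - 1) * (T : ℝ) ^ (2 / 3 : ℝ) := by
    have : (T : ℝ) ^ (2 / 3 : ℝ) = (T : ℝ) ^ (-(1 / 3) : ℝ) * T := by
      rw [← Real.rpow_add_one hT0.ne']
      norm_num
    rw [this]
    ring
  rwa [e1, e2, e3] at h

/-- A constant for the order of the expected regret. -/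
noncomputable def regretConst (A D : ℕ) (M : ℝ) : ℝ :=
  4 * √2 * (5 + 4 * Real.log ((A : ℝ) * D)) * A
    + (6 + 16 * (2 * Real.log (2 * √(Real.exp 1)) + 2 * Real.log ((A : ℝ) * D) + 4 / 3)) * A * M
    + 2 * A + 2 * M

/-- The summand `M` on the left accounts for the bad event, which has probability at most `1 / T`
and costs at most `T M`. As `T ≥ 2` gives `log T ≥ 1 / 2`, constants are absorbed into `log T` at
the price of doubling them, which explains `regretConst`. -/
theorem horizon_bound_le [NeZero A] [NeZero D] {T m : ℕ} (hT : 2 ≤ T) (hm : m ≤ A) {g M : ℝ}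
    (hg : 0 ≤ g) (hgM : g ≤ M) :
    4 * √2 * √(1 + 2 * Real.log ((A : ℝ) * D * √(T : ℝ) / (1 / (T : ℝ)))) * √(m * (T : ℝ))
        + (3 + 16 * (T : ℝ) ^ (2 / 3 : ℝ) *
            Real.log (2 * √(Real.exp 1) * A * D * (T : ℝ) ^ (1 / 3 : ℝ) / (1 / (T : ℝ)))) * m * g
        + ((A : ℝ) - 1) * (T : ℝ) ^ (2 / 3 : ℝ) + M ≤
      regretConst A D M * (T : ℝ) ^ (2 / 3 : ℝ) * Real.log T := by
  have hA : (1 : ℝ) ≤ A := by exact_mod_cast NeZero.one_le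
  have hD : (1 : ℝ) ≤ D := by exact_mod_cast NeZero.one_le
  have hT2 : (2 : ℝ) ≤ T := by exact_mod_cast hT
  have hT0 : (0 : ℝ) < T := by linarith
  have hmA : (m : ℝ) ≤ A := by exact_mod_cast hm
  have hm0 : (0 : ℝ) ≤ m := Nat.cast_nonneg m
  have hM : 0 ≤ M := hg.trans hgM
  have hc0 : 0 ≤ Real.log ((A : ℝ) * D) := Real.log_nonneg (by nlinarith)
  have hc1 : 0 ≤ Real.log (2 * √(Real.exp 1)) := by
    refine Real.log_nonneg ?_
    have : 1 ≤ √(Real.exp 1) := Real.one_le_sqrt.mpr (Real.one_le_exp zero_le_one)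
    linarith
  have hL : 1 / 2 ≤ Real.log T := by
    have h1 := Real.log_le_log (by norm_num) hT2
    have h2 := Real.log_two_gt_d9
    linarith
  have hp : 1 ≤ (T : ℝ) ^ (2 / 3 : ℝ) := Real.one_le_rpow (by linarith) (by norm_num)
  have hsq : √(T : ℝ) ≤ (T : ℝ) ^ (2 / 3 : ℝ) := by
    rw [Real.sqrt_eq_rpow]
    exact Real.rpow_le_rpow_of_exponent_le (by linarith) (by norm_num)
  have e1 : Real.log ((A : ℝ) * D * √(T : ℝ) / (1 / (T : ℝ))) =
      Real.log ((A : ℝ) * D) + 3 / 2 * Real.log T := by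
    rw [div_div_eq_mul_div, div_one, Real.log_mul (by positivity) (by positivity),
      Real.log_mul (by positivity) (by positivity), Real.log_sqrt hT0.le]
    ring
  have e2 : Real.log (2 * √(Real.exp 1) * A * D * (T : ℝ) ^ (1 / 3 : ℝ) / (1 / (T : ℝ))) =
      Real.log (2 * √(Real.exp 1)) + Real.log ((A : ℝ) * D) + 4 / 3 * Real.log T := by
    rw [div_div_eq_mul_div, div_one, Real.log_mul (by positivity) (by positivity),
      Real.log_mul (by positivity) (by positivity), Real.log_rpow hT0, mul_assoc (2 * √(Real.exp 1)),
      Real.log_mul (by positivity) (by positivity)]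
    ring
  rw [e1, e2, regretConst]
  set c0 := Real.log ((A : ℝ) * D)
  set c1 := Real.log (2 * √(Real.exp 1))
  set L := Real.log T
  set p := (T : ℝ) ^ (2 / 3 : ℝ)
  have hpL : 1 / 2 * p ≤ p * L := by nlinarith
  have hc0L : c0 ≤ 2 * c0 * L := by nlinarith
  have hc1L : c1 ≤ 2 * c1 * L := by nlinarith
  have t1 : √(1 + 2 * (c0 + 3 / 2 * L)) * √(m * (T : ℝ)) ≤ (5 + 4 * c0) * L * (A * p) := by
    refine mul_le_mul ?_ ?_ (Real.sqrt_nonneg _) (by positivity)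
    -- A number that is at least one dominates its square root, so the root can be dropped.
    · have h1 : 1 ≤ 1 + 2 * (c0 + 3 / 2 * L) := by linarith
      exact (Real.sqrt_le_iff.mpr ⟨by linarith, by nlinarith⟩).trans
        (by linarith : 1 + 2 * (c0 + 3 / 2 * L) ≤ (5 + 4 * c0) * L)
    · rw [Real.sqrt_mul hm0]
      refine mul_le_mul ?_ hsq (Real.sqrt_nonneg _) (by positivity)
      exact Real.sqrt_le_iff.mpr ⟨by linarith, by nlinarith⟩
  have t2 : (3 + 16 * p * (c1 + c0 + 4 / 3 * L)) * m * g ≤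
      ((6 + 16 * (2 * c1 + 2 * c0 + 4 / 3)) * p * L) * A * M := by
    have h1 : 3 + 16 * p * (c1 + c0 + 4 / 3 * L) ≤ (6 + 16 * (2 * c1 + 2 * c0 + 4 / 3)) * p * L := by
      have h2 : p * (c1 + c0 + 4 / 3 * L) ≤ p * ((2 * c1 + 2 * c0 + 4 / 3) * L) :=
        mul_le_mul_of_nonneg_left (by linarith) (by linarith)
      linarith
    gcongr
  have t3 : ((A : ℝ) - 1) * p ≤ 2 * A * (p * L) := by nlinarith
  have t4 : M ≤ 2 * M * (p * L) := by nlinarith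
  have t5 := mul_le_mul_of_nonneg_left t1 (by positivity : (0 : ℝ) ≤ 4 * √2)
  linarith

end PFLEX

/-! ### The three regret bounds -/

theorem theorem3 (A D : ℕ) [NeZero A] [NeZero D] :
    -- the bound for all horizons
    (∀ (E : LexBandit A D) (ε δ : ℝ), 0 < ε → 0 < δ → δ < 1 →
      ∀ π : (t : ℕ) → Kernel (History A D t) (Fin A), PFLEX.IsPolicy ε δ π →
      ∀ (Ω : Type*) [MeasurableSpace Ω] (P : Measure Ω) [IsProbabilityMeasure P]
        (a : ℕ → Ω → Fin A) (r : ℕ → Ω → Fin D → ℝ), E.IsInteraction π P a r →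
      1 - δ ≤ P.real {ω | ∀ (i : Fin D) (T : ℕ), 1 ≤ T →
        E.regret i T (fun t => a t ω) ≤
          4 * √2 * √(1 + 2 * Real.log ((A : ℝ) * D * √(T : ℝ) / δ)) *
              √((E.subopt i).ncard * (T : ℝ))
            + (3 + 16 / ε ^ 2 * Real.log (2 * √(Real.exp 1) * A * D / (ε * δ))) *
              (E.subopt i).ncard * E.gapMax i
            + ε * ((A : ℝ) - 1) * T}) ∧
    -- the bound for a given horizon `T`, with `ε = T ^ (-1/3)`
    (∀ (E : LexBandit A D) (T : ℕ) (δ : ℝ), 1 ≤ T → 0 < δ → δ < 1 →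
      ∀ π : (t : ℕ) → Kernel (History A D t) (Fin A),
        PFLEX.IsPolicy ((T : ℝ) ^ (-(1 / 3) : ℝ)) δ π →
      ∀ (Ω : Type*) [MeasurableSpace Ω] (P : Measure Ω) [IsProbabilityMeasure P]
        (a : ℕ → Ω → Fin A) (r : ℕ → Ω → Fin D → ℝ), E.IsInteraction π P a r →
      1 - δ ≤ P.real {ω | ∀ i : Fin D,
        E.regret i T (fun t => a t ω) ≤
          4 * √2 * √(1 + 2 * Real.log ((A : ℝ) * D * √(T : ℝ) / δ)) *
              √((E.subopt i).ncard * (T : ℝ))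
            + (3 + 16 * (T : ℝ) ^ (2 / 3 : ℝ) *
                Real.log (2 * √(Real.exp 1) * A * D * (T : ℝ) ^ (1 / 3 : ℝ) / δ)) *
              (E.subopt i).ncard * E.gapMax i
            + ((A : ℝ) - 1) * (T : ℝ) ^ (2 / 3 : ℝ)}) ∧
    -- the expected regret, with `ε = T ^ (-1/3)` and `δ = 1/T`
    (∀ M : ℝ, ∃ (C : ℝ) (k : ℕ), ∀ T : ℕ, 2 ≤ T →
      ∀ π : (t : ℕ) → Kernel (History A D t) (Fin A),
        PFLEX.IsPolicy ((T : ℝ) ^ (-(1 / 3) : ℝ)) (1 / (T : ℝ)) π →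
      ∀ (E : LexBandit A D) (Ω : Type*) [MeasurableSpace Ω] (P : Measure Ω)
        [IsProbabilityMeasure P] (a : ℕ → Ω → Fin A) (r : ℕ → Ω → Fin D → ℝ),
        E.IsInteraction π P a r →
      ∀ i : Fin D, E.gapMax i ≤ M →
        Integrable (fun ω => E.regret i T (fun t => a t ω)) P ∧
        ∫ ω, E.regret i T (fun t => a t ω) ∂P ≤
          C * (T : ℝ) ^ (2 / 3 : ℝ) * Real.log T ^ k) := by
  refine ⟨?_, ?_, ?_⟩
  · intro E ε δ hε hδ hδ1 π hπ Ω _ P _ a r hI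
    refine one_sub_le_measureReal hδ.le (le_trans (measure_mono ?_)
      (PFLEX.measure_not_valid_or_not_follows_le hπ hI hδ hδ1))
    intro ω hω hg
    exact hω fun i T _ => PFLEX.regret_le hε hδ hδ1 (fun t => (hg t).1) (fun t => (hg t).2) i T
  · intro E T δ hT hδ hδ1 π hπ Ω _ P _ a r hI
    refine one_sub_le_measureReal hδ.le (le_trans (measure_mono ?_)
      (PFLEX.measure_not_valid_or_not_follows_le hπ hI hδ hδ1))
    intro ω hω hg
    exact hω fun i => PFLEX.regret_le_of_horizon hT hδ hδ1 hg i
  · intro M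
    refine ⟨PFLEX.regretConst A D M, 1, ?_⟩
    intro T hT π hπ E Ω _ P _ a r hI i hM
    have hint := E.integrable_regret i T (P := P) hI.measurable_arm
    refine ⟨hint, ?_⟩
    have hT2 : (2 : ℝ) ≤ T := by exact_mod_cast hT
    have hδ : 0 < 1 / (T : ℝ) := by positivity
    have hδ1 : 1 / (T : ℝ) < 1 := by
      rw [div_lt_one (by linarith)]
      linarith
    have hbad := PFLEX.measure_not_valid_or_not_follows_le hπ hI hδ hδ1
    set bad := {ω | ¬ ∀ t, PFLEX.Valid E (1 / (T : ℝ)) (history a r t ω) ∧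
      PFLEX.Follows ((T : ℝ) ^ (-(1 / 3) : ℝ)) (1 / (T : ℝ)) (history a r t ω) (a t ω)} with hbaddef
    have hM0 : 0 ≤ M := (E.gapMax_nonneg i).trans hM
    have hm : (E.subopt i).ncard ≤ A := by
      have h := Set.ncard_le_ncard (Set.subset_univ (E.subopt i))
      rwa [Set.ncard_univ, Nat.card_fin] at h
    have hK := PFLEX.horizon_bound_le (A := A) (D := D) hT hm (E.gapMax_nonneg i) hM
    set K := PFLEX.regretConst A D M * (T : ℝ) ^ (2 / 3 : ℝ) * Real.log T with hKdef
    -- The measurable hull of the bad event has the same measure, so measurability of the event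
    -- itself need not be shown.
    have hreal : P.real (toMeasurable P bad) ≤ 1 / (T : ℝ) := by
      rw [Measure.real, measure_toMeasurable]
      exact ENNReal.toReal_le_of_le_ofReal hδ.le hbad
    -- Nonnegativity lets `K - M` stay in the pointwise bound on the bad event too, where `T M`
    -- alone already suffices.
    have hKM : 0 ≤ K - M := by
      refine le_trans ?_ (sub_le_sub_right hK M)
      have hA : (1 : ℝ) ≤ A := by exact_mod_cast NeZero.one_le
      have hD : (1 : ℝ) ≤ D := by exact_mod_cast NeZero.one_le
      have h2 : 0 ≤ Real.log (2 * √(Real.exp 1) * A * D * (T : ℝ) ^ (1 / 3 : ℝ) / (1 / (T : ℝ))) := by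
        refine Real.log_nonneg ?_
        have h3 : 1 ≤ √(Real.exp 1) := Real.one_le_sqrt.mpr (Real.one_le_exp zero_le_one)
        have h4 : 1 ≤ (T : ℝ) ^ (1 / 3 : ℝ) := Real.one_le_rpow (by linarith) (by norm_num)
        rw [div_div_eq_mul_div, div_one]
        have h5 : 1 ≤ 2 * √(Real.exp 1) := by linarith
        exact one_le_mul_of_one_le_of_one_le (one_le_mul_of_one_le_of_one_le
          (one_le_mul_of_one_le_of_one_le (one_le_mul_of_one_le_of_one_le h5 hA) hD) h4)
          (by linarith)
      have h6 := E.gapMax_nonneg i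
      have h7 : 0 ≤ (A : ℝ) - 1 := by linarith
      rw [add_sub_cancel_right]
      positivity
    have hpt : ∀ ω, E.regret i T (fun t => a t ω) ≤
        (K - M) + (toMeasurable P bad).indicator (fun _ => T * M) ω := by
      intro ω
      by_cases hω : ω ∈ toMeasurable P bad
      · rw [Set.indicator_of_mem hω]
        have h1 := E.regret_le_mul_gapMax i T fun t => a t ω
        have h2 := mul_le_mul_of_nonneg_left hM (by linarith : (0 : ℝ) ≤ T)
        linarith
      · rw [Set.indicator_of_notMem hω, add_zero]
        have hg := not_not.mp fun h => hω (subset_toMeasurable P bad h)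
        have h1 := PFLEX.regret_le_of_horizon (by omega) hδ hδ1 hg i
        linarith
    have hindm := measurableSet_toMeasurable P bad
    have hind : Integrable ((toMeasurable P bad).indicator fun _ => (T : ℝ) * M) P :=
      (integrable_const _).indicator hindm
    calc _ ≤ ∫ ω, ((K - M) + (toMeasurable P bad).indicator (fun _ => (T : ℝ) * M) ω) ∂P :=
          integral_mono hint ((integrable_const _).add hind) hpt
      _ = (K - M) + P.real (toMeasurable P bad) * (T * M) := by
          rw [integral_add (integrable_const _) hind, integral_const, integral_indicator hindm,
            setIntegral_const]
          simp
      _ ≤ (K - M) + 1 / (T : ℝ) * (T * M) := by gcongr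
      _ = K := by
          field_simp
          ring
      _ = _ := by rw [hKdef, pow_one]
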